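/- Let $M$ be a connected oriented smooth surface (Hausdorff, without boundary), $h$ a smooth Riemannian metric on $M$ with scalar curvature $R$ (twice the Gaussian curvature) and Levi-Civita connection $D$, and $J$ the complex structure determined by $h$ and the orientation. Let $\varepsilon\in\{1,-1\}$ and let $Y$ be a smooth vector field such that $(h,Y)$ solves the real vortex equations: $\mathcal L_Yh=0$ and $R+4\varepsilon|Y|_h^2=\tau$ for a constant $\tau$. Put $\gamma=h(Y,\cdot)$, $\omega=h(J\cdot,\cdot)$, $\star\alpha=-\alpha\circ J$ for one-forms $\alpha$, and define the function $\mathcal F$ by $-2\,d\gamma=\mathcal F\,\omega$. A metric $k$ is a steady gradient Ricci soliton with potential the smooth function $\varphi$ if $\tfrac12R_k\,k+\tfrac12\mathcal L_{X}k=0$, where $X$ is the $k$-gradient of $\varphi$. Then the function $R^2-\varepsilon\mathcal F^2$ is a constant $\sigma$, and if $Y$ is not identically zero the following are equivalent: 1. $\sigma=0$; 2. one of the functions $R+\mathcal F$, $R-\mathcal F$ is constant; 3. one of the functions $R+\mathcal F$, $R-\mathcal F$ vanishes identically. The equivalence of 1 and 3 holds also if $Y$ is identically zero. Whenever $\sigma=0$: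 4. Either $\varepsilon=-1$, $h$ is flat and $Y$ is parallel ($DY=0$); or $\varepsilon=1$ and $h$ is a steady gradient Ricci soliton with potential $-2\mu$ if $R+\mathcal F$ is constant, and $2\mu$ if $R-\mathcal F$ is constant, where $\mu$ is a primitive of $-\star\gamma$. Precisely, when $\varepsilon=1$: $h$ is a steady gradient Ricci soliton on $M$ for some smooth potential; if $h$ is not flat, then $-\star\gamma$ has a smooth primitive $\mu$ on $M$; and for every smooth covering $p:N\to M$ by a connected surface (for example the universal covering, or the identity of $M$) and every smooth $\mu:N\to\mathbb R$ with $d\mu=-p^*(\star\gamma)$, the metric $p^*h$ is a steady gradient Ricci soliton on $N$ with potential $-2\mu$ if $R+\mathcal F$ is constant, and with potential $2\mu$ if $R-\mathcal F$ is constant. 5. If $Y$ is not parallel, then neither $\mathcal F$ nor $R$ vanishes at any point of $M$. 6. If $Y$ has a zero, then one of the following holds: $h$ is flat and $Y$ is identically zero; $\max_MR=\tau<0$; or $0<R\le\tau=\max_MR$ on $M$. -/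

import Mathlib

open Bundle
open scoped Manifold ContDiff

universe u

namespace RealVortex

noncomputable section

/-- The model plane. A surface is a smooth manifold modelled on it, without boundary. -/
abbrev Plane : Type := EuclideanSpace ℝ (Fin 2)

variable {M : Type u} [TopologicalSpace M] [ChartedSpace Plane M]
  [IsManifold (𝓡 2) ∞ M]

/-- The vector field `X` is smooth at `x`. -/
def SmoothFieldAt (X : Π x : M, TangentSpace (𝓡 2) x) (x : M) : Prop :=
  ContMDiffAt (𝓡 2) ((𝓡 2).prod 𝓘(ℝ, Plane)) ∞
    (fun y => (TotalSpace.mk' Plane y (X y) : TangentBundle (𝓡 2) M)) x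

/-- The vector field `X` is smooth on the whole surface. -/
def SmoothField (X : Π x : M, TangentSpace (𝓡 2) x) : Prop :=
  ∀ x, SmoothFieldAt X x

variable (M) in
/-- Smooth Riemannian metrics on the surface `M`. -/
abbrev RiemMetric : Type u :=
  ContMDiffRiemannianMetric (𝓡 2) ∞ Plane (fun x : M => TangentSpace (𝓡 2) x)

/-- The function `h(X, W)`. -/
def pair (h : RiemMetric M) (X W : Π x : M, TangentSpace (𝓡 2) x) (x : M) : ℝ :=
  h.inner x (X x) (W x)

/-- The Lie bracket `[X, W]`. -/
abbrev bracket (X W : Π x : M, TangentSpace (𝓡 2) x) : Π x : M, TangentSpace (𝓡 2) x :=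
  VectorField.mlieBracket (𝓡 2) X W

/-- The derivative `X φ` of the function `φ` along the vector field `X`. -/
def dirDeriv (X : Π x : M, TangentSpace (𝓡 2) x) (φ : M → ℝ) (x : M) : ℝ :=
  mvfderiv (𝓡 2) φ x (X x)

/-! ### Levi-Civita connection and curvature -/

/-- The right-hand side of the Koszul formula for `h(D_X W, Z)`. -/
def koszul (h : RiemMetric M) (X W Z : Π x : M, TangentSpace (𝓡 2) x) (x : M) : ℝ :=
  (1 / 2 : ℝ) *
    (dirDeriv X (pair h W Z) x + dirDeriv W (pair h X Z) x - dirDeriv Z (pair h X W) x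
      + pair h (bracket X W) Z x - pair h (bracket X Z) W x - pair h (bracket W Z) X x)

/-- The Levi-Civita derivative `D_X W`: at `x` it is the tangent vector `u` determined by the
Koszul formula, `h(u, Z) = koszul h X W Z` for all `Z`. -/
def leviCivita (h : RiemMetric M) (X W : Π x : M, TangentSpace (𝓡 2) x) (x : M) :
    TangentSpace (𝓡 2) x :=
  Classical.epsilon fun u : TangentSpace (𝓡 2) x =>
    ∀ Z : Π y : M, TangentSpace (𝓡 2) y, SmoothFieldAt Z x →
      h.inner x u (Z x) = koszul h X W Z x

/-- `R(X, W) Z = D_X D_W Z - D_W D_X Z - D_[X, W] Z`. -/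
def curvature (h : RiemMetric M) (X W Z : Π x : M, TangentSpace (𝓡 2) x) (x : M) :
    TangentSpace (𝓡 2) x :=
  leviCivita h X (leviCivita h W Z) x - leviCivita h W (leviCivita h X Z) x
    - leviCivita h (bracket X W) Z x

/-- The standard basis of the tangent space at `x` (in the preferred chart at `x`). -/
def stdVec (x : M) (i : Fin 2) : TangentSpace (𝓡 2) x :=
  (EuclideanSpace.single i (1 : ℝ) : Plane)

/-- The `k`-th coordinate of a tangent vector in the basis `stdVec x`. -/
def coord {x : M} (v : TangentSpace (𝓡 2) x) (k : Fin 2) : ℝ :=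
  (show Plane from v) k

/-- An extension of the tangent vector `v` at `x` to a vector field that is smooth at `x`. -/
abbrev extendVec {x : M} (v : TangentSpace (𝓡 2) x) : Π y : M, TangentSpace (𝓡 2) y :=
  FiberBundle.extend Plane v

/-- The Ricci tensor `Ric(V, W) = tr (Z ↦ R(Z, V) W)` on basis vectors. -/
def ricci (h : RiemMetric M) (x : M) (i j : Fin 2) : ℝ :=
  ∑ k : Fin 2, coord (curvature h (extendVec (stdVec x k)) (extendVec (stdVec x i)) (extendVec (stdVec x j)) x) k

/-- The matrix of the metric at `x`. -/
def gram (h : RiemMetric M) (x : M) : Matrix (Fin 2) (Fin 2) ℝ :=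
  Matrix.of fun i j => h.inner x (stdVec x i) (stdVec x j)

/-- The scalar curvature, the `h`-trace of the Ricci tensor (twice the Gaussian curvature). -/
def scalarCurvature (h : RiemMetric M) (x : M) : ℝ :=
  ∑ i : Fin 2, ∑ j : Fin 2, (gram h x)⁻¹ i j * ricci h x i j

/-- The metric `h` is flat: its Riemann curvature tensor vanishes. -/
def IsFlat (h : RiemMetric M) : Prop :=
  ∀ (x : M) (X W Z : Π y : M, TangentSpace (𝓡 2) y),
    SmoothFieldAt X x → SmoothFieldAt W x → SmoothFieldAt Z x → curvature h X W Z x = 0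

/-- The vector field `Y` is parallel, `D Y = 0`. -/
def IsParallel (h : RiemMetric M) (Y : Π x : M, TangentSpace (𝓡 2) x) : Prop :=
  ∀ (x : M) (X : Π y : M, TangentSpace (𝓡 2) y), SmoothFieldAt X x → leviCivita h X Y x = 0

/-! ### Killing fields, gradient Ricci solitons -/

/-- The Lie derivative `(𝓛_Y h)(V, W) = Y h(V, W) - h([Y, V], W) - h(V, [Y, W])`. -/
def lieDerivMetric (h : RiemMetric M) (Y V W : Π x : M, TangentSpace (𝓡 2) x) (x : M) : ℝ :=
  dirDeriv Y (pair h V W) x - pair h (bracket Y V) W x - pair h V (bracket Y W) x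

/-- `Y` is a Killing field of `h`, `𝓛_Y h = 0`. -/
def IsKilling (h : RiemMetric M) (Y : Π x : M, TangentSpace (𝓡 2) x) : Prop :=
  ∀ (x : M) (V W : Π y : M, TangentSpace (𝓡 2) y),
    SmoothFieldAt V x → SmoothFieldAt W x → lieDerivMetric h Y V W x = 0

/-- `h` is a gradient Ricci soliton with potential `φ` and constant `c`:
`(1/2) R h + (1/2) 𝓛_X h = c h`, where `X` is the `h`-gradient of the smooth function `φ`. -/
def IsGradientRicciSoliton (h : RiemMetric M) (φ : M → ℝ) (c : ℝ) : Prop :=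
  ContMDiff (𝓡 2) 𝓘(ℝ, ℝ) ∞ φ ∧
  ∃ X : Π x : M, TangentSpace (𝓡 2) x, SmoothField X ∧
    (∀ (x : M) (v : TangentSpace (𝓡 2) x), h.inner x (X x) v = mvfderiv (𝓡 2) φ x v) ∧
    ∀ (x : M) (V W : Π y : M, TangentSpace (𝓡 2) y), SmoothFieldAt V x → SmoothFieldAt W x →
      (1 / 2 : ℝ) * scalarCurvature h x * pair h V W x
        + (1 / 2 : ℝ) * lieDerivMetric h X V W x = c * pair h V W x

/-- A gradient Ricci soliton is steady when its constant is zero. -/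
def IsSteadyGradientRicciSoliton (h : RiemMetric M) (φ : M → ℝ) : Prop :=
  IsGradientRicciSoliton h φ 0

/-! ### Oriented surfaces and the objects attached to `(h, Y)` -/

/-- `J` is the complex structure determined by `h` and an orientation of the surface: the
rotation by the angle `π / 2` in each tangent space, depending smoothly on the point. For a fixed
metric, such a `J` is the same thing as an orientation. -/
structure IsComplexStructure (h : RiemMetric M)
    (J : Π x : M, TangentSpace (𝓡 2) x →L[ℝ] TangentSpace (𝓡 2) x) : Prop where
  smooth : ContMDiff (𝓡 2) ((𝓡 2).prod 𝓘(ℝ, Plane →L[ℝ] Plane)) ∞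
    (fun x => (TotalSpace.mk' (Plane →L[ℝ] Plane) x (J x) :
      TotalSpace (Plane →L[ℝ] Plane)
        (fun x : M => TangentSpace (𝓡 2) x →L[ℝ] TangentSpace (𝓡 2) x)))
  sq : ∀ (x : M) (v : TangentSpace (𝓡 2) x), J x (J x v) = -v
  isometry : ∀ (x : M) (v w : TangentSpace (𝓡 2) x),
    h.inner x (J x v) (J x w) = h.inner x v w

/-- The Kähler form `ω(v, w) = h(J v, w)`. -/
def kahlerForm (h : RiemMetric M) (J : Π x : M, TangentSpace (𝓡 2) x →L[ℝ] TangentSpace (𝓡 2) x)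
    (x : M) (v w : TangentSpace (𝓡 2) x) : ℝ :=
  h.inner x (J x v) w

/-- The one-form `γ = h(Y, ·)` dual to `Y`. -/
def gammaForm (h : RiemMetric M) (Y : Π x : M, TangentSpace (𝓡 2) x) (x : M) :
    TangentSpace (𝓡 2) x →L[ℝ] ℝ :=
  h.inner x (Y x)

/-- The Hodge star on one-forms, `⋆ α = - α ∘ J`. -/
def hodgeStar (J : Π x : M, TangentSpace (𝓡 2) x →L[ℝ] TangentSpace (𝓡 2) x)
    (α : Π x : M, TangentSpace (𝓡 2) x →L[ℝ] ℝ) (x : M) : TangentSpace (𝓡 2) x →L[ℝ] ℝ :=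
  -((α x).comp (J x))

/-- The exterior derivative of a one-form, `dα(V, W) = V α(W) - W α(V) - α([V, W])`. -/
def extDerivOne (α : Π x : M, TangentSpace (𝓡 2) x →L[ℝ] ℝ)
    (V W : Π x : M, TangentSpace (𝓡 2) x) (x : M) : ℝ :=
  dirDeriv V (fun y => α y (W y)) x - dirDeriv W (fun y => α y (V y)) x - α x (bracket V W x)

/-- The Faraday curvature `F = - dγ`, on tangent vectors at `x`. -/
def faraday (h : RiemMetric M) (Y : Π x : M, TangentSpace (𝓡 2) x) (x : M)
    (v w : TangentSpace (𝓡 2) x) : ℝ :=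
  -extDerivOne (gammaForm h Y) (extendVec v) (extendVec w) x

/-- The function `𝓕` with `2 F = 𝓕 ω`. Two-forms on a plane are proportional, so the factor is
read off on the basis `v, J v`, where `v` is any non-zero tangent vector. -/
def faradayFunction (h : RiemMetric M)
    (J : Π x : M, TangentSpace (𝓡 2) x →L[ℝ] TangentSpace (𝓡 2) x)
    (Y : Π x : M, TangentSpace (𝓡 2) x) (x : M) : ℝ :=
  2 * faraday h Y x (stdVec x 0) (J x (stdVec x 0))
    / kahlerForm h J x (stdVec x 0) (J x (stdVec x 0))

/-- `(h, Y)` solves the real vortex equations with sign `ε` and vortex parameter `τ`: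
`Y` is a smooth Killing field of `h` and `R + 4 ε |Y|² = τ`. -/
structure IsRealVortex (h : RiemMetric M) (Y : Π x : M, TangentSpace (𝓡 2) x) (ε τ : ℝ) : Prop where
  smooth : SmoothField Y
  killing : IsKilling h Y
  vortex : ∀ x, scalarCurvature h x + 4 * ε * h.inner x (Y x) (Y x) = τ

/-- The metric `k` on `N` is the pullback `p^* h`. -/
def IsPullbackMetric {N : Type u} [TopologicalSpace N] [ChartedSpace Plane N]
    [IsManifold (𝓡 2) ∞ N] (p : N → M) (h : RiemMetric M) (k : RiemMetric N) : Prop :=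
  ∀ (y : N) (v w : TangentSpace (𝓡 2) y),
    k.inner y v w = h.inner (p y) (mfderiv (𝓡 2) (𝓡 2) p y v) (mfderiv (𝓡 2) (𝓡 2) p y w)

/-- `μ` is a moment map on `N`: a smooth primitive of the pullback of `- ⋆ γ` along `p : N → M`. -/
def IsMomentMap {N : Type u} [TopologicalSpace N] [ChartedSpace Plane N]
    (p : N → M) (h : RiemMetric M)
    (J : Π x : M, TangentSpace (𝓡 2) x →L[ℝ] TangentSpace (𝓡 2) x)
    (Y : Π x : M, TangentSpace (𝓡 2) x) (μ : N → ℝ) : Prop :=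
  ContMDiff (𝓡 2) 𝓘(ℝ, ℝ) ∞ μ ∧
  ∀ (y : N) (v : TangentSpace (𝓡 2) y),
    mvfderiv (𝓡 2) μ y v
      = -(hodgeStar J (gammaForm h Y) (p y) (mfderiv (𝓡 2) (𝓡 2) p y v))

end

end RealVortex

open RealVortex

/-! On a surface everything reduces to a linear system for `R` and `𝓕`. Write `η = h(Y, J ·)`, which
is `-⋆γ`. A Killing field has skew covariant derivative, and a skew endomorphism of a plane is a
multiple of `J`, so `D_V Y = -(𝓕/4) J V` (`IsKilling.leviCivita_eq`). Differentiating once more and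
comparing with the curvature, which in dimension two is `R/2` times the constant-curvature tensor
(`curvature_eq`), gives `d𝓕 = 2Rη`. The vortex equation and `d|Y|² = -(𝓕/2)η` give `dR = 2ε𝓕η`.
Hence `R² - ε𝓕²` is constant.

If `ε = -1` and `σ = 0`, a sum of squares vanishes, so `R = 𝓕 = 0`: the metric is flat and `Y` is
parallel. If `ε = 1`, each function `g = R + s𝓕` with `s = ±1` satisfies `dg = 2s g η`, so on a
connected surface it vanishes everywhere or nowhere (`eq_zero_of_mvfderiv_eq`). Since `σ = (R + 𝓕)(R
- 𝓕)`, one of the two vanishes identically as soon as `σ = 0`. Then `dR = -2sRη`, so `R` too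
vanishes everywhere or nowhere, and in the second case `-(s/2) log |R|` is a primitive of `η`.

For the solitons, let `dμ = η`. The gradient of `-2sμ` is `2s JY`, and since `J` is parallel,
`D_V(2s JY) = (s𝓕/2) V`. The soliton tensor is therefore `(1/2)(R + s𝓕)` times the metric. The
computation is local, so it passes to any `N` that is locally diffeomorphic to `M`. -/

namespace RealVortex

open Filter Topology

set_option linter.unusedSectionVars false
set_option linter.style.haveILetI false

/-! ### Regularity of vector fields, products and directional derivatives. -/

section FirstOrder

variable {M : Type u} [TopologicalSpace M] [ChartedSpace Plane M] [IsManifold (𝓡 2) ∞ M]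

/-- The vector field `X` is differentiable at `x`. -/
def DiffFieldAt (X : Π x : M, TangentSpace (𝓡 2) x) (x : M) : Prop :=
  MDifferentiableAt (𝓡 2) ((𝓡 2).prod 𝓘(ℝ, Plane))
    (fun y => (TotalSpace.mk' Plane y (X y) : TangentBundle (𝓡 2) M)) x

/-- The real function `f` is smooth at `x`. -/
abbrev SmoothFunAt (f : M → ℝ) (x : M) : Prop := ContMDiffAt (𝓡 2) 𝓘(ℝ, ℝ) ∞ f x

/-- The real function `f` is differentiable at `x`. -/
abbrev DiffFunAt (f : M → ℝ) (x : M) : Prop := MDifferentiableAt (𝓡 2) 𝓘(ℝ, ℝ) f x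

variable {X W Z X' W' Z' : Π x : M, TangentSpace (𝓡 2) x} {f g : M → ℝ} {x : M} {h : RiemMetric M}

lemma SmoothFieldAt.diff (hX : SmoothFieldAt X x) : DiffFieldAt X x :=
  ContMDiffAt.mdifferentiableAt hX (by simp)

lemma SmoothFunAt.diff (hf : SmoothFunAt f x) : DiffFunAt f x :=
  ContMDiffAt.mdifferentiableAt hf (by simp)

/-- Being `C^∞` at a point means `C^n` near it for each `n`, with no common neighbourhood; order one
already gives a neighbourhood of differentiability. -/
lemma SmoothFieldAt.eventually_diff (hX : SmoothFieldAt X x) : ∀ᶠ y in 𝓝 x, DiffFieldAt X y := by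
  have h1 : ContMDiffAt (𝓡 2) ((𝓡 2).prod 𝓘(ℝ, Plane)) 1
    (fun y => (TotalSpace.mk' Plane y (X y) : TangentBundle (𝓡 2) M)) x := ContMDiffAt.of_le hX (by simp)
  filter_upwards [(contMDiffAt_iff_contMDiffAt_nhds (by simp)).1 h1] with y hy
  exact ContMDiffAt.mdifferentiableAt hy (by simp)

lemma SmoothFunAt.eventually_diff (hf : SmoothFunAt f x) : ∀ᶠ y in 𝓝 x, DiffFunAt f y := by
  have h1 : ContMDiffAt (𝓡 2) 𝓘(ℝ, ℝ) 1 f x := ContMDiffAt.of_le hf (by simp)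
  filter_upwards [(contMDiffAt_iff_contMDiffAt_nhds (by simp)).1 h1] with y hy
  exact ContMDiffAt.mdifferentiableAt hy (by simp)

lemma DiffFieldAt.add (hX : DiffFieldAt X x) (hW : DiffFieldAt W x) : DiffFieldAt (X + W) x :=
  mdifferentiableAt_add_section hX hW

lemma DiffFieldAt.smul (hf : DiffFunAt f x) (hX : DiffFieldAt X x) : DiffFieldAt (f • X) x :=
  MDifferentiableAt.smul_section hf hX

lemma SmoothFieldAt.add (hX : SmoothFieldAt X x) (hW : SmoothFieldAt W x) :
    SmoothFieldAt (X + W) x :=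
  ContMDiffAt.add_section hX hW

lemma SmoothFieldAt.smul (hf : SmoothFunAt f x) (hX : SmoothFieldAt X x) :
    SmoothFieldAt (f • X) x :=
  ContMDiffAt.smul_section hf hX

lemma SmoothFieldAt.bracket (hX : SmoothFieldAt X x) (hW : SmoothFieldAt W x) :
    SmoothFieldAt (bracket X W) x := by
  haveI : IsManifold (𝓡 2) (((⊤ : ℕ∞) : WithTop ℕ∞) + 1) M := by
    simpa using ‹IsManifold (𝓡 2) ∞ M›
  haveI : IsManifold (𝓡 2) (minSmoothness ℝ 2) M := by
    rw [minSmoothness_of_isRCLikeNormedField]; infer_instance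
  exact ContMDiffAt.mlieBracket_vectorField (m := ⊤) (n := ⊤) hX hW (by simp)

lemma smoothFieldAt_extendVec (v : TangentSpace (𝓡 2) x) : SmoothFieldAt (extendVec v) x :=
  FiberBundle.contMDiffAt_extend (I := 𝓡 2) (F := Plane) v

@[simp] lemma extendVec_self (v : TangentSpace (𝓡 2) x) : extendVec v x = v :=
  FiberBundle.extend_apply_self Plane v

lemma DiffFieldAt.pair (h : RiemMetric M) (hX : DiffFieldAt X x) (hW : DiffFieldAt W x) :
    DiffFunAt (pair h X W) x := by
  have : MDifferentiableAt (𝓡 2) ((𝓡 2).prod 𝓘(ℝ))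
      (fun m ↦ TotalSpace.mk' ℝ (E := Bundle.Trivial M ℝ) m (h.inner m (X m) (W m))) x := by
    apply MDifferentiableAt.clm_bundle_apply₂ (F₁ := Plane) (F₂ := Plane)
    · exact (h.contMDiff x).mdifferentiableAt (by simp)
    · exact hX
    · exact hW
  simp only [mdifferentiableAt_totalSpace] at this
  exact this.2

lemma SmoothFieldAt.pair (h : RiemMetric M) (hX : SmoothFieldAt X x) (hW : SmoothFieldAt W x) :
    SmoothFunAt (pair h X W) x := by
  have : ContMDiffAt (𝓡 2) ((𝓡 2).prod 𝓘(ℝ)) ∞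
      (fun m ↦ TotalSpace.mk' ℝ (E := Bundle.Trivial M ℝ) m (h.inner m (X m) (W m))) x := by
    apply ContMDiffAt.clm_bundle_apply₂ (F₁ := Plane) (F₂ := Plane)
    · exact h.contMDiff x
    · exact hX
    · exact hW
  simp only [contMDiffAt_totalSpace] at this
  exact this.2

lemma SmoothFieldAt.dirDeriv (hX : SmoothFieldAt X x) (hf : SmoothFunAt f x) :
    SmoothFunAt (dirDeriv X f) x := by
  have key := ContMDiffAt.clm_apply_of_inCoordinates (𝕜 := ℝ) (n := ∞) (b₁ := id) (b₂ := f)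
    (F₁ := Plane) (F₂ := ℝ)
    (E₁ := fun y : M => TangentSpace (𝓡 2) y) (E₂ := fun y : ℝ => TangentSpace 𝓘(ℝ, ℝ) y)
    (ϕ := fun y => mfderiv (𝓡 2) 𝓘(ℝ, ℝ) f y) (v := X) (m₀ := x)
    (IM := 𝓡 2) (IB₁ := 𝓡 2) (IB₂ := 𝓘(ℝ, ℝ))
    (ContMDiffAt.mfderiv_const (m := ∞) (n := ∞) hf (by simp)) hX hf
  rw [contMDiffAt_totalSpace] at key
  have k2 := key.2
  simp at k2
  exact k2

end FirstOrder

/-! ### The Levi-Civita connection from the Koszul formula. -/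

section Connection

variable {M : Type u} [TopologicalSpace M] [ChartedSpace Plane M] [IsManifold (𝓡 2) ∞ M]
variable {X W Z X' W' Z' : Π x : M, TangentSpace (𝓡 2) x} {f g : M → ℝ} {x : M} {h : RiemMetric M}

instance : IsManifold (𝓡 2) (minSmoothness ℝ 2) M := by
  rw [minSmoothness_of_isRCLikeNormedField]; infer_instance

lemma dirDeriv_add (hf : DiffFunAt f x) (hg : DiffFunAt g x) :
    dirDeriv X (f + g) x = dirDeriv X f x + dirDeriv X g x := by
  simp [dirDeriv, mvfderiv_add hf hg]

lemma dirDeriv_mul (hf : DiffFunAt f x) (hg : DiffFunAt g x) :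
    dirDeriv X (f * g) x = f x * dirDeriv X g x + g x * dirDeriv X f x := by
  simp [dirDeriv, mvfderiv_mul hf hg]

lemma dirDeriv_add_left : dirDeriv (X + W) f x = dirDeriv X f x + dirDeriv W f x := by
  simp [dirDeriv]

lemma dirDeriv_smul_left : dirDeriv (g • X) f x = g x * dirDeriv X f x := by
  simp [dirDeriv]

lemma dirDeriv_congr (hfg : f =ᶠ[𝓝 x] g) : dirDeriv X f x = dirDeriv X g x := by
  simp only [dirDeriv, mvfderiv, hfg.mfderiv_eq]
  rfl

lemma pair_comm : pair h X W = pair h W X := funext fun x => h.symm x _ _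

lemma pair_add_left : pair h (X + X') W = pair h X W + pair h X' W := by
  ext x; simp [pair]

lemma pair_add_right : pair h W (X + X') = pair h W X + pair h W X' := by
  ext x; simp [pair]

lemma pair_smul_left : pair h (f • X) W = f * pair h X W := by
  ext x; simp [pair]

lemma pair_smul_right : pair h W (f • X) = f * pair h W X := by
  ext x; simp [pair]

lemma bracket_add_right (hW : DiffFieldAt W x) (hW' : DiffFieldAt W' x) :
    bracket X (W + W') x = bracket X W x + bracket X W' x :=
  VectorField.mlieBracket_add_right hW hW'

lemma bracket_add_left (hW : DiffFieldAt W x) (hW' : DiffFieldAt W' x) :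
    bracket (W + W') X x = bracket W X x + bracket W' X x :=
  VectorField.mlieBracket_add_left hW hW'

lemma bracket_smul_right (hf : DiffFunAt f x) (hW : DiffFieldAt W x) :
    bracket X (f • W) x = dirDeriv X f x • W x + f x • bracket X W x :=
  VectorField.mlieBracket_smul_right hf hW

lemma bracket_smul_left (hf : DiffFunAt f x) (hW : DiffFieldAt W x) :
    bracket (f • W) X x = - dirDeriv X f x • W x + f x • bracket W X x :=
  VectorField.mlieBracket_smul_left hf hW

lemma bracket_swap : bracket X W x = - bracket W X x :=
  VectorField.mlieBracket_swap_apply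

/-- On replacing `Z` by `f • Z`, the terms in `X f` and `W f` from the first two derivatives cancel
those from `[X, Z]` and `[W, Z]`. The Koszul expression is thus a linear form in `Z x`, which the
metric can represent. -/
lemma tensorialAt_koszul (hX : DiffFieldAt X x) (hW : DiffFieldAt W x) :
    TensorialAt (𝓡 2) Plane (fun Z => koszul h X W Z x) x where
  smul {f Z} hf hZ := by
    have hXZ := DiffFieldAt.pair h hX hZ
    have hWZ := DiffFieldAt.pair h hW hZ
    simp only [koszul, pair_smul_right, dirDeriv_mul hf hXZ, dirDeriv_mul hf hWZ,
      dirDeriv_smul_left]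
    simp only [pair, bracket_smul_right hf hZ, map_add, map_smul, add_apply,
      smul_apply, smul_eq_mul, Pi.mul_apply]
    rw [h.symm x (Z x) (W x), h.symm x (Z x) (X x)]
    ring
  add {Z Z'} hZ hZ' := by
    simp only [koszul, pair_add_right, dirDeriv_add (DiffFieldAt.pair h hX hZ) (DiffFieldAt.pair h hX hZ'),
      dirDeriv_add (DiffFieldAt.pair h hW hZ) (DiffFieldAt.pair h hW hZ'),
      dirDeriv_add_left]
    simp only [pair, bracket_add_right hZ hZ', map_add, add_apply, Pi.add_apply]
    ring

lemma inner_eq_zero_iff (v : TangentSpace (𝓡 2) x) : h.inner x v v = 0 ↔ v = 0 := by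
  refine ⟨fun hv => ?_, fun hv => by simp [hv]⟩
  by_contra hne
  exact (h.pos x v hne).ne' hv

lemma inner_left_ext {u v : TangentSpace (𝓡 2) x} (huv : ∀ w, h.inner x u w = h.inner x v w) :
    u = v := by
  rw [← sub_eq_zero, ← inner_eq_zero_iff (h := h)]
  simp [huv]

instance : FiniteDimensional ℝ (TangentSpace (𝓡 2) x) :=
  inferInstanceAs (FiniteDimensional ℝ Plane)

/-- Every linear form on a tangent space is represented by a vector. -/
lemma exists_inner_eq (h : RiemMetric M) (φ : TangentSpace (𝓡 2) x →ₗ[ℝ] ℝ) :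
    ∃ u, ∀ w, h.inner x u w = φ w := by
  let T : TangentSpace (𝓡 2) x →ₗ[ℝ] Module.Dual ℝ (TangentSpace (𝓡 2) x) :=
    { toFun := fun u => (h.inner x u : TangentSpace (𝓡 2) x →ₗ[ℝ] ℝ)
      map_add' := fun a b => by ext; simp
      map_smul' := fun a b => by ext; simp }
  have hT : Function.Injective T := fun u v huv =>
    inner_left_ext (h := h) fun w => LinearMap.congr_fun huv w
  have hT' := (LinearMap.injective_iff_surjective_of_finrank_eq_finrank
    (Subspace.dual_finrank_eq (K := ℝ) (V := TangentSpace (𝓡 2) x)).symm).1 hT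
  obtain ⟨u, hu⟩ := hT' φ
  exact ⟨u, fun w => LinearMap.congr_fun hu w⟩

/-- Tensoriality and nondegeneracy provide the vector that `Classical.epsilon` asks for. The
definition tests only smooth `Z`; dependence on `Z x` alone extends the formula to differentiable
`Z`. -/
lemma inner_leviCivita (h : RiemMetric M) (hX : DiffFieldAt X x) (hW : DiffFieldAt W x)
    (hZ : DiffFieldAt Z x) :
    h.inner x (leviCivita h X W x) (Z x) = koszul h X W Z x := by
  have hK := tensorialAt_koszul (h := h) hX hW
  have hex : ∃ u : TangentSpace (𝓡 2) x, ∀ Z : Π y : M, TangentSpace (𝓡 2) y, SmoothFieldAt Z x →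
      h.inner x u (Z x) = koszul h X W Z x := by
    obtain ⟨u, hu⟩ := exists_inner_eq h (hK.mkHom).toLinearMap
    exact ⟨u, fun Z hZ => (hu _).trans (TensorialAt.mkHom_apply hK hZ.diff)⟩
  have := Classical.epsilon_spec hex _ (smoothFieldAt_extendVec (Z x))
  rw [extendVec_self] at this
  exact this.trans (hK.pointwise (smoothFieldAt_extendVec (Z x)).diff hZ (extendVec_self _))

/-- A tangent vector is `D_X W` as soon as it satisfies the Koszul formula. -/
lemma eq_leviCivita (hX : DiffFieldAt X x) (hW : DiffFieldAt W x) {u : TangentSpace (𝓡 2) x}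
    (hu : ∀ Z : Π y : M, TangentSpace (𝓡 2) y, DiffFieldAt Z x →
      h.inner x u (Z x) = koszul h X W Z x) : leviCivita h X W x = u := by
  refine inner_left_ext (h := h) fun w => ?_
  have hw := (smoothFieldAt_extendVec w).diff
  have h1 := inner_leviCivita h hX hW hw
  have h2 := hu _ hw
  rw [extendVec_self] at h1 h2
  rw [h1, h2]

lemma koszul_congr (hX : X =ᶠ[𝓝 x] X') (hW : W =ᶠ[𝓝 x] W') :
    koszul h X W Z x = koszul h X' W' Z x := by
  have h1 : pair h W Z =ᶠ[𝓝 x] pair h W' Z := by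
    filter_upwards [hW] with y hy; simp [pair, hy]
  have h2 : pair h X Z =ᶠ[𝓝 x] pair h X' Z := by
    filter_upwards [hX] with y hy; simp [pair, hy]
  have h3 : pair h X W =ᶠ[𝓝 x] pair h X' W' := by
    filter_upwards [hX, hW] with y hy hy'; simp [pair, hy, hy']
  have b1 : bracket X W x = bracket X' W' x := hX.mlieBracket_vectorField_eq hW
  have b2 : bracket X Z x = bracket X' Z x := hX.mlieBracket_vectorField_eq .rfl
  have b3 : bracket W Z x = bracket W' Z x := hW.mlieBracket_vectorField_eq .rfl
  have e1 : dirDeriv X (pair h W Z) x = dirDeriv X' (pair h W' Z) x := by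
    rw [dirDeriv_congr h1]; simp only [dirDeriv, hX.eq_of_nhds]
  have e2 : dirDeriv W (pair h X Z) x = dirDeriv W' (pair h X' Z) x := by
    rw [dirDeriv_congr h2]; simp only [dirDeriv, hW.eq_of_nhds]
  simp only [koszul, e1, e2, dirDeriv_congr h3]
  simp only [pair, b1, b2, b3, hX.eq_of_nhds, hW.eq_of_nhds]

/-- Locality allows an inner derivative to be rewritten inside an outer one by an identity that
holds only near `x`. -/
lemma leviCivita_congr (hX : X =ᶠ[𝓝 x] X') (hW : W =ᶠ[𝓝 x] W') :
    leviCivita h X W x = leviCivita h X' W' x := by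
  simp only [leviCivita, koszul_congr hX hW]

lemma leviCivita_add_right (hX : DiffFieldAt X x) (hW : DiffFieldAt W x) (hW' : DiffFieldAt W' x) :
    leviCivita h X (W + W') x = leviCivita h X W x + leviCivita h X W' x := by
  refine eq_leviCivita hX (hW.add hW') fun Z hZ => ?_
  rw [map_add, add_apply, inner_leviCivita h hX hW hZ, inner_leviCivita h hX hW' hZ]
  simp only [koszul, pair_add_left, pair_add_right,
    dirDeriv_add (DiffFieldAt.pair h hW hZ) (DiffFieldAt.pair h hW' hZ),
    dirDeriv_add (DiffFieldAt.pair h hX hW) (DiffFieldAt.pair h hX hW'), dirDeriv_add_left]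
  simp only [pair, bracket_add_right hW hW', bracket_add_left hW hW', map_add, add_apply,
    Pi.add_apply]
  ring

lemma leviCivita_add_left (hX : DiffFieldAt X x) (hX' : DiffFieldAt X' x) (hW : DiffFieldAt W x) :
    leviCivita h (X + X') W x = leviCivita h X W x + leviCivita h X' W x := by
  refine eq_leviCivita (hX.add hX') hW fun Z hZ => ?_
  rw [map_add, add_apply, inner_leviCivita h hX hW hZ, inner_leviCivita h hX' hW hZ]
  simp only [koszul, pair_add_left, pair_add_right,
    dirDeriv_add (DiffFieldAt.pair h hX hZ) (DiffFieldAt.pair h hX' hZ),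
    dirDeriv_add (DiffFieldAt.pair h hX hW) (DiffFieldAt.pair h hX' hW), dirDeriv_add_left]
  simp only [pair, bracket_add_left hX hX', map_add, add_apply,
    Pi.add_apply]
  ring

/-- The Leibniz rule `D_X (f W) = (X f) W + f D_X W`. -/
lemma leviCivita_smul_right (hf : DiffFunAt f x) (hX : DiffFieldAt X x) (hW : DiffFieldAt W x) :
    leviCivita h X (f • W) x = dirDeriv X f x • W x + f x • leviCivita h X W x := by
  refine eq_leviCivita hX (hW.smul hf) fun Z hZ => ?_
  simp only [map_add, map_smul, add_apply, smul_apply, smul_eq_mul, inner_leviCivita h hX hW hZ]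
  simp only [koszul, pair_smul_left, pair_smul_right, dirDeriv_mul hf (DiffFieldAt.pair h hW hZ),
    dirDeriv_mul hf (DiffFieldAt.pair h hX hW), dirDeriv_smul_left]
  simp only [pair, bracket_smul_right hf hW, bracket_smul_left hf hW, map_add, map_smul, add_apply,
      smul_apply, smul_eq_mul, Pi.mul_apply]
  rw [h.symm x (W x) (X x)]
  ring

lemma leviCivita_smul_left (hf : DiffFunAt f x) (hX : DiffFieldAt X x) (hW : DiffFieldAt W x) :
    leviCivita h (f • X) W x = f x • leviCivita h X W x := by
  refine eq_leviCivita (hX.smul hf) hW fun Z hZ => ?_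
  simp only [map_smul, smul_apply, smul_eq_mul, inner_leviCivita h hX hW hZ]
  simp only [koszul, pair_smul_left, pair_smul_right, dirDeriv_mul hf (DiffFieldAt.pair h hX hZ),
    dirDeriv_mul hf (DiffFieldAt.pair h hX hW), dirDeriv_smul_left]
  simp only [pair, bracket_smul_left hf hX, map_add, map_smul, add_apply,
      smul_apply, smul_eq_mul, Pi.mul_apply]
  ring

lemma tensorialAt_leviCivita_left (hW : DiffFieldAt W x) :
    TensorialAt (𝓡 2) Plane (fun X => leviCivita h X W x) x where
  smul hf hX := leviCivita_smul_left hf hX hW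
  add hX hX' := leviCivita_add_left hX hX' hW

lemma leviCivita_torsion (hX : DiffFieldAt X x) (hW : DiffFieldAt W x) :
    leviCivita h X W x - leviCivita h W X x = bracket X W x := by
  refine inner_left_ext (h := h) fun w => ?_
  have hw := (smoothFieldAt_extendVec w).diff
  have h1 := inner_leviCivita h hX hW hw
  have h2 := inner_leviCivita h hW hX hw
  rw [extendVec_self] at h1 h2
  rw [map_sub, sub_apply, h1, h2]
  simp only [koszul]
  rw [pair_comm (X := W) (W := X)]
  simp only [pair, bracket_swap (X := W) (W := X), map_neg, neg_apply, extendVec_self]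
  ring

lemma leviCivita_metric (h : RiemMetric M) (hX : DiffFieldAt X x) (hW : DiffFieldAt W x)
    (hZ : DiffFieldAt Z x) :
    dirDeriv X (pair h W Z) x
      = h.inner x (leviCivita h X W x) (Z x) + h.inner x (W x) (leviCivita h X Z x) := by
  rw [h.symm x (W x), inner_leviCivita h hX hW hZ, inner_leviCivita h hX hZ hW]
  simp only [koszul]
  rw [pair_comm (X := Z) (W := W)]
  simp only [pair, bracket_swap (X := Z) (W := W), map_neg, neg_apply]
  ring

end Connection

/-! ### The curvature tensor of a surface. -/

section Curvature

variable {M : Type u} [TopologicalSpace M] [ChartedSpace Plane M] [IsManifold (𝓡 2) ∞ M]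
variable {X W Z X' W' Z' V : Π x : M, TangentSpace (𝓡 2) x} {f g : M → ℝ} {x : M} {h : RiemMetric M}

instance : IsManifold (𝓡 2) (minSmoothness ℝ 3) M := by
  rw [minSmoothness_of_isRCLikeNormedField]; infer_instance

lemma smoothFunAt_const (c : ℝ) : SmoothFunAt (fun _ : M => c) x := contMDiffAt_const

lemma dirDeriv_const (c : ℝ) : dirDeriv X (fun _ : M => c) x = 0 := by
  simp [dirDeriv, mvfderiv_const]

lemma eventually_bracket_smul_right (hf : SmoothFunAt f x) (hW : SmoothFieldAt W x) :
    bracket X (f • W) =ᶠ[𝓝 x] dirDeriv X f • W + f • bracket X W := by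
  filter_upwards [hf.eventually_diff, hW.eventually_diff] with y h1 h2
  exact bracket_smul_right h1 h2

lemma leibniz_bracket (hX : SmoothFieldAt X x) (hW : SmoothFieldAt W x) (hZ : SmoothFieldAt Z x) :
    bracket X (bracket W Z) x = bracket (bracket X W) Z x + bracket W (bracket X Z) x := by
  have h2 : minSmoothness ℝ 2 ≤ ∞ := by
    rw [minSmoothness_of_isRCLikeNormedField]; norm_cast
  exact VectorField.leibniz_identity_mlieBracket_apply (ContMDiffAt.of_le hX h2)
    (ContMDiffAt.of_le hW h2) (ContMDiffAt.of_le hZ h2)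

instance : Nontrivial (TangentSpace (𝓡 2) x) := inferInstanceAs (Nontrivial Plane)

lemma bracket_bracket_smul (hW : SmoothFieldAt W x)
    (hZ : SmoothFieldAt Z x) (hf : SmoothFunAt f x) :
    bracket X (bracket W (f • Z)) x = dirDeriv X (dirDeriv W f) x • Z x
      + dirDeriv W f x • bracket X Z x + dirDeriv X f x • bracket W Z x
      + f x • bracket X (bracket W Z) x := by
  have h1 : bracket X (bracket W (f • Z)) x
      = bracket X (dirDeriv W f • Z + f • bracket W Z) x :=
    EventuallyEq.rfl.mlieBracket_vectorField_eq (eventually_bracket_smul_right hf hZ)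
  rw [h1, bracket_add_right (hZ.smul (hW.dirDeriv hf)).diff ((hW.bracket hZ).smul hf).diff,
    bracket_smul_right (hW.dirDeriv hf).diff hZ.diff,
    bracket_smul_right hf.diff (hW.bracket hZ).diff]
  abel

/-- `[X, W] f = X (W f) - W (X f)`. -/
lemma dirDeriv_bracket (hX : SmoothFieldAt X x) (hW : SmoothFieldAt W x) (hf : SmoothFunAt f x) :
    dirDeriv (bracket X W) f x = dirDeriv X (dirDeriv W f) x - dirDeriv W (dirDeriv X f) x := by
  obtain ⟨v, hv⟩ := exists_ne (0 : TangentSpace (𝓡 2) x)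
  have hZ := smoothFieldAt_extendVec v
  -- The Jacobi identity for `X`, `W`, `f • Z`, minus `f` times the one for `X`, `W`, `Z`, leaves
  -- the claimed difference times `Z`; and `Z x = v` is nonzero.
  have e1 := leibniz_bracket hX hW (hZ.smul hf)
  have e2 := leibniz_bracket hX hW hZ
  rw [bracket_bracket_smul hW hZ hf, bracket_bracket_smul hX hZ hf, e2,
    bracket_smul_right hf.diff hZ.diff, extendVec_self] at e1
  have e3 : (dirDeriv (bracket X W) f x
      - (dirDeriv X (dirDeriv W f) x - dirDeriv W (dirDeriv X f) x)) • v = 0 := by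
    rw [eq_comm, ← sub_eq_zero] at e1
    rw [← e1]
    module
  rcases smul_eq_zero.1 e3 with h0 | h0
  · linarith
  · exact absurd h0 hv

lemma stdVec_coord_sum (v : TangentSpace (𝓡 2) x) :
    v = coord v 0 • stdVec x 0 + coord v 1 • stdVec x 1 := by
  have : ∀ v : Plane, v = v 0 • EuclideanSpace.single (0 : Fin 2) (1 : ℝ)
      + v 1 • EuclideanSpace.single (1 : Fin 2) (1 : ℝ) := fun v => by
    ext i; fin_cases i <;> simp
  exact this v

/-- The Gram determinant of two tangent vectors. -/
noncomputable def gramDet (h : RiemMetric M) (X W : Π x : M, TangentSpace (𝓡 2) x) (x : M) : ℝ :=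
  pair h X X x * pair h W W x - pair h X W x * pair h X W x

/-- Cramer's rule for the expansion of `v` in `a`, `b`. -/
lemma gram_identity (h : RiemMetric M) (a b v : TangentSpace (𝓡 2) x) :
    (h.inner x a a * h.inner x b b - h.inner x a b * h.inner x a b) • v
      = (h.inner x b b * h.inner x a v - h.inner x a b * h.inner x b v) • a
        + (h.inner x a a * h.inner x b v - h.inner x a b * h.inner x a v) • b := by
  have hs := h.symm x (stdVec x 1) (stdVec x 0)
  rw [stdVec_coord_sum a, stdVec_coord_sum b, stdVec_coord_sum v]
  simp only [map_add, map_smul, add_apply, smul_apply, smul_eq_mul, hs]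
  module

lemma gramDet_stdVec_pos (h : RiemMetric M) (x : M) :
    0 < h.inner x (stdVec x 0) (stdVec x 0) * h.inner x (stdVec x 1) (stdVec x 1)
      - h.inner x (stdVec x 0) (stdVec x 1) * h.inner x (stdVec x 0) (stdVec x 1) := by
  have e0 : stdVec x 0 ≠ 0 := fun h0 => by
    have : (EuclideanSpace.single (0 : Fin 2) (1 : ℝ) : Plane) = 0 := h0
    simpa using congr_fun (congrArg WithLp.ofLp this) 0
  have p0 := h.pos x _ e0
  set a := h.inner x (stdVec x 0) (stdVec x 0) with ha
  set b := h.inner x (stdVec x 0) (stdVec x 1) with hb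
  -- The squared length of this vector is `a` times the Gram determinant.
  have ew : a • stdVec x 1 - b • stdVec x 0 ≠ 0 := fun h0 => by
    have : (a • EuclideanSpace.single (1 : Fin 2) (1 : ℝ)
      - b • EuclideanSpace.single (0 : Fin 2) (1 : ℝ) : Plane) = 0 := h0
    exact p0.ne' (by simpa using congr_fun (congrArg WithLp.ofLp this) 1)
  have p1 := h.pos x _ ew
  simp only [map_sub, map_smul, sub_apply, smul_apply, smul_eq_mul,
    h.symm x (stdVec x 1) (stdVec x 0), ← ha, ← hb] at p1
  have : 0 < a * (a * h.inner x (stdVec x 1) (stdVec x 1) - b * b) := by linarith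
  exact (pos_iff_pos_of_mul_pos this).1 p0

/-- A vector field whose products with smooth fields are smooth has smooth coefficients in the frame
that extends the standard basis at `x`. -/
lemma exists_smooth_coeff (h : RiemMetric M)
    (hV : ∀ E : Π y : M, TangentSpace (𝓡 2) y, SmoothFieldAt E x → SmoothFunAt (pair h V E) x) :
    ∃ c d : M → ℝ, SmoothFunAt c x ∧ SmoothFunAt d x ∧
      V =ᶠ[𝓝 x] c • extendVec (stdVec x 0) + d • extendVec (stdVec x 1) := by
  set A : Π y : M, TangentSpace (𝓡 2) y := extendVec (stdVec x 0) with hA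
  set B : Π y : M, TangentSpace (𝓡 2) y := extendVec (stdVec x 1) with hB
  have sA : SmoothFieldAt A x := smoothFieldAt_extendVec _
  have sB : SmoothFieldAt B x := smoothFieldAt_extendVec _
  have sd : SmoothFunAt (gramDet h A B) x :=
    ((sA.pair h sA).mul (sB.pair h sB)).sub ((sA.pair h sB).mul (sA.pair h sB))
  have hd : gramDet h A B x ≠ 0 := by
    have := (gramDet_stdVec_pos h x).ne'
    simpa [gramDet, pair, hA, hB] using this
  have sd' : SmoothFunAt (fun y => (gramDet h A B y)⁻¹) x := sd.inv₀ hd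
  -- The coefficients of Cramer's rule `gram_identity`; the Gram determinant is nonzero at `x`,
  -- hence near `x`.
  refine ⟨fun y => (gramDet h A B y)⁻¹ * (pair h B B * pair h V A - pair h A B * pair h V B) y,
    fun y => (gramDet h A B y)⁻¹ * (pair h A A * pair h V B - pair h A B * pair h V A) y,
    sd'.mul (((sB.pair h sB).mul (hV A sA)).sub ((sA.pair h sB).mul (hV B sB))),
    sd'.mul (((sA.pair h sA).mul (hV B sB)).sub ((sA.pair h sB).mul (hV A sA))), ?_⟩
  filter_upwards [sd.continuousAt.eventually_ne hd] with y hy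
  have := gram_identity h (A y) (B y) (V y)
  simp only [Pi.smul_apply', Pi.add_apply, Pi.sub_apply, Pi.mul_apply, pair, h.symm y (V y),
    mul_smul]
  rw [← smul_add, ← this, smul_smul]
  exact (one_smul ℝ (V y)).symm.trans (by rw [← inv_mul_cancel₀ hy]; rfl)

/-- A vector field is smooth as soon as its products with smooth vector fields are. -/
lemma smoothFieldAt_of_pair (h : RiemMetric M)
    (hV : ∀ E : Π y : M, TangentSpace (𝓡 2) y, SmoothFieldAt E x → SmoothFunAt (pair h V E) x) :
    SmoothFieldAt V x := by
  obtain ⟨c, d, hc, hd, hcd⟩ := exists_smooth_coeff h hV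
  have hs := SmoothFieldAt.add (SmoothFieldAt.smul hc (smoothFieldAt_extendVec (stdVec x 0)))
    (SmoothFieldAt.smul hd (smoothFieldAt_extendVec (stdVec x 1)))
  refine ContMDiffAt.congr_of_eventuallyEq hs ?_
  filter_upwards [hcd] with y hy
  rw [hy]

lemma eventually_pair_leviCivita (hX : SmoothFieldAt X x) (hW : SmoothFieldAt W x)
    (hZ : SmoothFieldAt Z x) : pair h (leviCivita h X W) Z =ᶠ[𝓝 x] koszul h X W Z := by
  filter_upwards [hX.eventually_diff, hW.eventually_diff, hZ.eventually_diff] with y h1 h2 h3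
  exact inner_leviCivita h h1 h2 h3

/-- The choice in the definition carries no regularity. Near `x`, however, the products with smooth
fields are Koszul expressions, which are smooth, and these determine the field. -/
lemma SmoothFieldAt.leviCivita (hX : SmoothFieldAt X x) (hW : SmoothFieldAt W x) :
    SmoothFieldAt (leviCivita h X W) x := by
  refine smoothFieldAt_of_pair h fun E hE => ?_
  refine ContMDiffAt.congr_of_eventuallyEq ?_ (eventually_pair_leviCivita hX hW hE)
  refine ContMDiffAt.mul contMDiffAt_const ?_
  exact (((((hX.dirDeriv (hW.pair h hE)).add (hW.dirDeriv (hX.pair h hE))).sub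
    (hE.dirDeriv (hX.pair h hW))).add ((hX.bracket hW).pair h hE)).sub
    ((hX.bracket hE).pair h hW)).sub ((hW.bracket hE).pair h hX)

/-- An operation on vector fields that respects sums and multiples by functions, for fields and
functions that are smooth at `x`. -/
structure SmoothTensorialAt {A : Type*} [AddCommGroup A] [Module ℝ A]
    (Φ : (Π y : M, TangentSpace (𝓡 2) y) → A) (x : M) : Prop where
  smul : ∀ {f : M → ℝ} {X : Π y : M, TangentSpace (𝓡 2) y}, SmoothFunAt f x → SmoothFieldAt X x →
    Φ (f • X) = f x • Φ X
  add : ∀ {X W : Π y : M, TangentSpace (𝓡 2) y}, SmoothFieldAt X x → SmoothFieldAt W x →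
    Φ (X + W) = Φ X + Φ W

namespace SmoothTensorialAt

variable {A : Type*} [AddCommGroup A] [Module ℝ A] {Φ Ψ : (Π y : M, TangentSpace (𝓡 2) y) → A}

/-- The indicator `ψ` of the set where `X` and `W` agree serves as cutoff: it equals 1 near `x`, so
it is smooth at `x`, and `ψ • X = ψ • W` everywhere. -/
lemma congr_germ (hΦ : SmoothTensorialAt Φ x) (hX : SmoothFieldAt X x) (hW : SmoothFieldAt W x)
    (hXW : X =ᶠ[𝓝 x] W) : Φ X = Φ W := by
  classical
  let ψ (y : M) : ℝ := if X y = W y then 1 else 0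
  have h1 : ψ x = 1 := by simp [ψ, hXW.eq_of_nhds]
  have h2 : ψ • X = ψ • W := by
    ext1 y
    simp only [Pi.smul_apply', ψ]
    split_ifs with hy <;> simp [hy]
  have h3 : SmoothFunAt ψ x :=
    (smoothFunAt_const 1).congr_of_eventuallyEq (hXW.mono fun y hy => by simp [ψ, hy])
  calc Φ X = Φ (ψ • X) := by simp [hΦ.smul h3 hX, h1]
    _ = Φ W := by rw [h2]; simp [hΦ.smul h3 hW, h1]

lemma sub (hΦ : SmoothTensorialAt Φ x) (hΨ : SmoothTensorialAt Ψ x) :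
    SmoothTensorialAt (fun X => Φ X - Ψ X) x where
  smul hf hX := by rw [hΦ.smul hf hX, hΨ.smul hf hX, smul_sub]
  add hX hW := by rw [hΦ.add hX hW, hΨ.add hX hW]; abel

/-- Near `x` a smooth field is a combination, with coefficients smooth at `x`, of the two extended
basis fields, so checking these two suffices. Smooth inputs are required because the operations of
interest involve second derivatives. -/
lemma eq_zero_of_stdVec (h : RiemMetric M) (hΦ : SmoothTensorialAt Φ x)
    (h0 : ∀ i, Φ (extendVec (stdVec x i)) = 0) (hX : SmoothFieldAt X x) : Φ X = 0 := by
  obtain ⟨c, d, hc, hd, hcd⟩ := exists_smooth_coeff h fun E hE => hX.pair h hE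
  have s0 := smoothFieldAt_extendVec (stdVec x 0)
  have s1 := smoothFieldAt_extendVec (stdVec x 1)
  rw [hΦ.congr_germ hX ((s0.smul hc).add (s1.smul hd)) hcd, hΦ.add (s0.smul hc) (s1.smul hd),
    hΦ.smul hc s0, hΦ.smul hd s1, h0, h0]
  simp

lemma eq_of_stdVec (h : RiemMetric M) (hΦ : SmoothTensorialAt Φ x) (hΨ : SmoothTensorialAt Ψ x)
    (h0 : ∀ i, Φ (extendVec (stdVec x i)) = Ψ (extendVec (stdVec x i))) (hX : SmoothFieldAt X x) :
    Φ X = Ψ X :=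
  sub_eq_zero.1 <| (hΦ.sub hΨ).eq_zero_of_stdVec h (fun i => by simp [h0 i]) hX

end SmoothTensorialAt

lemma leviCivita_neg_left (hX : DiffFieldAt X x) (hW : DiffFieldAt W x) :
    leviCivita h (-X) W x = - leviCivita h X W x := by
  have := leviCivita_smul_left (h := h) (f := fun _ : M => (-1 : ℝ)) mdifferentiableAt_const hX hW
  have e : (fun _ : M => (-1 : ℝ)) • X = -X := by ext1 y; simp
  rw [e] at this
  simpa using this

lemma curvature_swap (hX : SmoothFieldAt X x) (hW : SmoothFieldAt W x) (hZ : SmoothFieldAt Z x) :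
    curvature h X W Z x = - curvature h W X Z x := by
  have : bracket X W = - bracket W X := VectorField.mlieBracket_swap
  simp only [curvature, this, leviCivita_neg_left (hW.bracket hX).diff hZ.diff]
  abel

lemma curvature_smul_left (hf : SmoothFunAt f x) (hX : SmoothFieldAt X x) (hW : SmoothFieldAt W x)
    (hZ : SmoothFieldAt Z x) : curvature h (f • X) W Z x = f x • curvature h X W Z x := by
  have e1 : leviCivita h (f • X) Z =ᶠ[𝓝 x] f • leviCivita h X Z := by
    filter_upwards [hf.eventually_diff, hX.eventually_diff, hZ.eventually_diff] with y h1 h2 h3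
    exact leviCivita_smul_left h1 h2 h3
  have e2 : bracket (f • X) W =ᶠ[𝓝 x] (-dirDeriv W f) • X + f • bracket X W := by
    filter_upwards [hf.eventually_diff, hX.eventually_diff] with y h1 h2
    exact bracket_smul_left h1 h2
  have s1 : SmoothFunAt (-dirDeriv W f) x := (hW.dirDeriv hf).neg
  have hZ' := hZ.diff
  simp only [curvature]
  rw [leviCivita_smul_left hf.diff hX.diff (hW.leviCivita hZ).diff,
    leviCivita_congr (h := h) (EventuallyEq.refl _ W) e1,
    leviCivita_smul_right hf.diff hW.diff (hX.leviCivita hZ).diff,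
    leviCivita_congr e2 (EventuallyEq.refl _ Z),
    leviCivita_add_left (hX.smul s1).diff ((hX.bracket hW).smul hf).diff hZ',
    leviCivita_smul_left s1.diff hX.diff hZ',
    leviCivita_smul_left hf.diff (hX.bracket hW).diff hZ']
  simp only [Pi.neg_apply]
  module

lemma curvature_add_left (hX : SmoothFieldAt X x) (hX' : SmoothFieldAt X' x)
    (hW : SmoothFieldAt W x) (hZ : SmoothFieldAt Z x) :
    curvature h (X + X') W Z x = curvature h X W Z x + curvature h X' W Z x := by
  have e1 : leviCivita h (X + X') Z =ᶠ[𝓝 x] leviCivita h X Z + leviCivita h X' Z := by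
    filter_upwards [hX'.eventually_diff, hX.eventually_diff, hZ.eventually_diff] with y h1 h2 h3
    exact leviCivita_add_left h2 h1 h3
  have e2 : bracket (X + X') W =ᶠ[𝓝 x] bracket X W + bracket X' W := by
    filter_upwards [hX.eventually_diff, hX'.eventually_diff] with y h1 h2
    exact bracket_add_left h1 h2
  simp only [curvature]
  rw [leviCivita_add_left hX.diff hX'.diff (hW.leviCivita hZ).diff,
    leviCivita_congr (h := h) (EventuallyEq.refl _ W) e1,
    leviCivita_add_right hW.diff (hX.leviCivita hZ).diff (hX'.leviCivita hZ).diff,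
    leviCivita_congr e2 (EventuallyEq.refl _ Z),
    leviCivita_add_left (hX.bracket hW).diff (hX'.bracket hW).diff hZ.diff]
  abel

lemma leviCivita_leviCivita_smul (hf : SmoothFunAt f x) (hX : SmoothFieldAt X x)
    (hW : SmoothFieldAt W x) (hZ : SmoothFieldAt Z x) :
    leviCivita h X (leviCivita h W (f • Z)) x
      = dirDeriv X (dirDeriv W f) x • Z x + dirDeriv W f x • leviCivita h X Z x
        + dirDeriv X f x • leviCivita h W Z x + f x • leviCivita h X (leviCivita h W Z) x := by
  have e1 : leviCivita h W (f • Z) =ᶠ[𝓝 x] dirDeriv W f • Z + f • leviCivita h W Z := by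
    filter_upwards [hf.eventually_diff, hW.eventually_diff, hZ.eventually_diff] with y h1 h2 h3
    exact leviCivita_smul_right h1 h2 h3
  rw [leviCivita_congr (h := h) (EventuallyEq.refl _ X) e1,
    leviCivita_add_right hX.diff (hZ.smul (hW.dirDeriv hf)).diff ((hW.leviCivita hZ).smul hf).diff,
    leviCivita_smul_right (hW.dirDeriv hf).diff hX.diff hZ.diff,
    leviCivita_smul_right hf.diff hX.diff (hW.leviCivita hZ).diff]
  abel

/-- The first-order terms cancel by symmetry, and the second derivatives of `f` are absorbed by the
`[X, W]` term through `dirDeriv_bracket`. -/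
lemma curvature_smul_right (hf : SmoothFunAt f x) (hX : SmoothFieldAt X x)
    (hW : SmoothFieldAt W x) (hZ : SmoothFieldAt Z x) :
    curvature h X W (f • Z) x = f x • curvature h X W Z x := by
  simp only [curvature]
  rw [leviCivita_leviCivita_smul hf hX hW hZ, leviCivita_leviCivita_smul hf hW hX hZ,
    leviCivita_smul_right hf.diff (hX.bracket hW).diff hZ.diff, dirDeriv_bracket hX hW hf]
  module

lemma curvature_add_right (hX : SmoothFieldAt X x)
    (hW : SmoothFieldAt W x) (hZ : SmoothFieldAt Z x) (hZ' : SmoothFieldAt Z' x) :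
    curvature h X W (Z + Z') x = curvature h X W Z x + curvature h X W Z' x := by
  have e {W : Π y : M, TangentSpace (𝓡 2) y} (hW : SmoothFieldAt W x) :
      leviCivita h W (Z + Z') =ᶠ[𝓝 x] leviCivita h W Z + leviCivita h W Z' := by
    filter_upwards [hW.eventually_diff, hZ'.eventually_diff, hZ.eventually_diff] with y h1 h2 h3
    exact leviCivita_add_right h1 h3 h2
  simp only [curvature]
  rw [leviCivita_congr (h := h) (EventuallyEq.refl _ X) (e hW),
    leviCivita_congr (h := h) (EventuallyEq.refl _ W) (e hX),
    leviCivita_add_right hX.diff (hW.leviCivita hZ).diff (hW.leviCivita hZ').diff,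
    leviCivita_add_right hW.diff (hX.leviCivita hZ).diff (hX.leviCivita hZ').diff,
    leviCivita_add_right (hX.bracket hW).diff hZ.diff hZ'.diff]
  abel

lemma smoothTensorialAt_curvature_left (hW : SmoothFieldAt W x) (hZ : SmoothFieldAt Z x) :
    SmoothTensorialAt (fun X => curvature h X W Z x) x where
  smul hf hX := curvature_smul_left hf hX hW hZ
  add hX hX' := curvature_add_left hX hX' hW hZ

lemma smoothTensorialAt_curvature_middle (hX : SmoothFieldAt X x) (hZ : SmoothFieldAt Z x) :
    SmoothTensorialAt (fun W => curvature h X W Z x) x where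
  smul {f W} hf hW := by
    rw [curvature_swap hX (hW.smul hf) hZ, curvature_smul_left hf hW hX hZ,
      curvature_swap hW hX hZ, smul_neg, neg_neg]
  add {W W'} hW hW' := by
    rw [curvature_swap hX (hW.add hW') hZ, curvature_add_left hW hW' hX hZ,
      curvature_swap hX hW hZ, curvature_swap hX hW' hZ, neg_add]

lemma smoothTensorialAt_curvature_right (hX : SmoothFieldAt X x) (hW : SmoothFieldAt W x) :
    SmoothTensorialAt (fun Z => curvature h X W Z x) x where
  smul hf hZ := curvature_smul_right hf hX hW hZ
  add hZ hZ' := curvature_add_right hX hW hZ hZ'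

lemma dirDeriv_dirDeriv_pair (hX : SmoothFieldAt X x) (hW : SmoothFieldAt W x)
    (hZ : SmoothFieldAt Z x) (hV : SmoothFieldAt V x) :
    dirDeriv X (dirDeriv W (pair h Z V)) x
      = h.inner x (leviCivita h X (leviCivita h W Z) x) (V x)
        + h.inner x (leviCivita h W Z x) (leviCivita h X V x)
        + h.inner x (leviCivita h X Z x) (leviCivita h W V x)
        + h.inner x (Z x) (leviCivita h X (leviCivita h W V) x) := by
  have e : dirDeriv W (pair h Z V) =ᶠ[𝓝 x]
      pair h (leviCivita h W Z) V + pair h Z (leviCivita h W V) := by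
    filter_upwards [hW.eventually_diff, hZ.eventually_diff, hV.eventually_diff] with y h1 h2 h3
    exact leviCivita_metric h h1 h2 h3
  rw [dirDeriv_congr e, dirDeriv_add ((hW.leviCivita hZ).pair h hV).diff
      (hZ.pair h (hW.leviCivita hV)).diff,
    leviCivita_metric h hX.diff (hW.leviCivita hZ).diff hV.diff,
    leviCivita_metric h hX.diff hZ.diff (hW.leviCivita hV).diff]
  ring

/-- The curvature operators are skew. -/
lemma inner_curvature_swap (hX : SmoothFieldAt X x) (hW : SmoothFieldAt W x)
    (hZ : SmoothFieldAt Z x) (hV : SmoothFieldAt V x) :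
    h.inner x (curvature h X W Z x) (V x) = - h.inner x (Z x) (curvature h X W V x) := by
  -- The function `h(Z, V)` is differentiated by `X W - W X - [X, W] = 0`; the mixed terms of
  -- `dirDeriv_dirDeriv_pair` are symmetric in `X` and `W` and drop out.
  have e1 := dirDeriv_bracket hX hW (hZ.pair h hV)
  rw [dirDeriv_dirDeriv_pair hX hW hZ hV, dirDeriv_dirDeriv_pair hW hX hZ hV,
    leviCivita_metric h (hX.bracket hW).diff hZ.diff hV.diff] at e1
  simp only [curvature, map_sub, sub_apply]
  linarith

@[simp] lemma coord_stdVec (i j : Fin 2) : coord (stdVec x i) j = if j = i then 1 else 0 := by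
  have : ∀ i j : Fin 2, (EuclideanSpace.single i (1 : ℝ) : Plane) j = if j = i then 1 else 0 := by
    intro i j; simp
  exact this i j

lemma coord_sub (v w : TangentSpace (𝓡 2) x) (k : Fin 2) : coord (v - w) k = coord v k - coord w k :=
  rfl

lemma coord_smul (c : ℝ) (v : TangentSpace (𝓡 2) x) (k : Fin 2) : coord (c • v) k = c * coord v k :=
  rfl

/-- On a surface the curvature tensor is determined by one function. -/
lemma exists_curvature_eq (h : RiemMetric M) (x : M) :
    ∃ κ : ℝ, ∀ X W Z : Π y : M, TangentSpace (𝓡 2) y, SmoothFieldAt X x → SmoothFieldAt W x →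
      SmoothFieldAt Z x → curvature h X W Z x
        = κ • (h.inner x (W x) (Z x) • X x - h.inner x (X x) (Z x) • W x) := by
  set E : Fin 2 → Π y : M, TangentSpace (𝓡 2) y := fun i => extendVec (stdVec x i) with hE
  have sE : ∀ i, SmoothFieldAt (E i) x := fun i => smoothFieldAt_extendVec _
  have eE : ∀ i, E i x = stdVec x i := fun i => extendVec_self _
  set t := h.inner x (curvature h (E 0) (E 1) (E 1) x) (stdVec x 0) with ht
  set g : Fin 2 → Fin 2 → ℝ := fun i j => h.inner x (stdVec x i) (stdVec x j) with hg
  have gs : g 1 0 = g 0 1 := h.symm _ _ _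
  have hd := (gramDet_stdVec_pos h x).ne'
  set D := h.inner x (stdVec x 0) (stdVec x 0) * h.inner x (stdVec x 1) (stdVec x 1)
      - h.inner x (stdVec x 0) (stdVec x 1) * h.inner x (stdVec x 0) (stdVec x 1) with hD
  -- Skewness of the operator `R(E 0, E 1)` leaves the single free entry `t`; dividing by the Gram
  -- determinant `D` gives the Gaussian curvature.
  have sk : ∀ j k, h.inner x (stdVec x k) (curvature h (E 0) (E 1) (E j) x)
      = - h.inner x (stdVec x j) (curvature h (E 0) (E 1) (E k) x) := fun j k => by
    have := inner_curvature_swap (h := h) (sE 0) (sE 1) (sE j) (sE k)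
    rw [eE, eE, h.symm] at this
    exact this
  have ex : ∀ v : TangentSpace (𝓡 2) x, v = D⁻¹ •
      ((g 1 1 * h.inner x (stdVec x 0) v - g 0 1 * h.inner x (stdVec x 1) v) • stdVec x 0
        + (g 0 0 * h.inner x (stdVec x 1) v - g 0 1 * h.inner x (stdVec x 0) v) • stdVec x 1) := by
    intro v
    rw [← gram_identity h (stdVec x 0) (stdVec x 1) v, smul_smul, inv_mul_cancel₀ hd, one_smul]
  have c01 : ∀ k, curvature h (E 0) (E 1) (E k) x
      = (t / D) • (g 1 k • stdVec x 0 - g 0 k • stdVec x 1) := by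
    have z0 : h.inner x (stdVec x 0) (curvature h (E 0) (E 1) (E 0) x) = 0 := by
      have := sk 0 0; linarith
    have z1 : h.inner x (stdVec x 1) (curvature h (E 0) (E 1) (E 1) x) = 0 := by
      have := sk 1 1; linarith
    have z2 : h.inner x (stdVec x 0) (curvature h (E 0) (E 1) (E 1) x) = t := h.symm _ _ _
    have z3 : h.inner x (stdVec x 1) (curvature h (E 0) (E 1) (E 0) x) = -t := by
      rw [sk 0 1, z2]
    intro k
    rw [ex (curvature h (E 0) (E 1) (E k) x)]
    fin_cases k
    · simp only [Fin.zero_eta, z0, z3, gs]; module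
    · simp only [Fin.mk_one, z1, z2]; module
  have cE : ∀ i j k, curvature h (E i) (E j) (E k) x
      = (t / D) • (g j k • stdVec x i - g i k • stdVec x j) := by
    intro i j k
    have self : ∀ i, curvature h (E i) (E i) (E k) x = 0 := fun i => by
      have h1 := add_eq_zero_iff_eq_neg.2 (curvature_swap (h := h) (sE i) (sE i) (sE k))
      rw [← two_smul ℝ] at h1
      exact (smul_eq_zero.1 h1).resolve_left two_ne_zero
    fin_cases i <;> fin_cases j
    · simp [self]
    · simpa using c01 k
    · simp only [Fin.mk_one, Fin.zero_eta]
      rw [curvature_swap (sE 1) (sE 0) (sE k), c01]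
      module
    · simp [self]
  refine ⟨t / D, fun X W Z hX hW hZ => ?_⟩
  refine (smoothTensorialAt_curvature_left hW hZ).eq_of_stdVec h
    (Ψ := fun X => (t / D) • (h.inner x (W x) (Z x) • X x - h.inner x (X x) (Z x) • W x))
    ⟨fun _ _ => ?_, fun _ _ => ?_⟩ (fun i => ?_) hX
  · simp only [Pi.smul_apply', map_smul, smul_apply, smul_eq_mul]; module
  · simp only [Pi.add_apply, map_add, add_apply]; module
  refine (smoothTensorialAt_curvature_middle (sE i) hZ).eq_of_stdVec h
    (Ψ := fun W => (t / D) • (h.inner x (W x) (Z x) • E i x - h.inner x (E i x) (Z x) • W x))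
    ⟨fun _ _ => ?_, fun _ _ => ?_⟩ (fun j => ?_) hW
  · simp only [Pi.smul_apply', map_smul, smul_apply, smul_eq_mul]; module
  · simp only [Pi.add_apply, map_add, add_apply]; module
  refine (smoothTensorialAt_curvature_right (sE i) (sE j)).eq_of_stdVec h
    (Ψ := fun Z => (t / D) • (h.inner x (E j x) (Z x) • E i x - h.inner x (E i x) (Z x) • E j x))
    ⟨fun _ _ => ?_, fun _ _ => ?_⟩ (fun k => ?_) hZ
  · simp only [Pi.smul_apply', map_smul, smul_eq_mul]; module
  · simp only [Pi.add_apply, map_add]; module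
  refine (cE i j k).trans ?_
  simp only [extendVec_self, eE, hg]

/-- The factor `κ` is identified by tracing: the Ricci tensor is `κ` times the metric, whose own
trace is 2. -/
lemma curvature_eq (h : RiemMetric M) (hX : SmoothFieldAt X x) (hW : SmoothFieldAt W x)
    (hZ : SmoothFieldAt Z x) :
    curvature h X W Z x = (scalarCurvature h x / 2) •
      (h.inner x (W x) (Z x) • X x - h.inner x (X x) (Z x) • W x) := by
  obtain ⟨κ, hκ⟩ := exists_curvature_eq h x
  rw [hκ X W Z hX hW hZ]
  congr 1
  have hr : ∀ i j, ricci h x i j = κ * gram h x i j := fun i j => by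
    simp only [ricci, hκ _ _ _ (smoothFieldAt_extendVec _) (smoothFieldAt_extendVec _)
      (smoothFieldAt_extendVec _), coord_smul, coord_sub, coord_stdVec, extendVec_self, gram,
      Matrix.of_apply, Fin.sum_univ_two]
    fin_cases i <;> fin_cases j <;> simp
  have hdet : IsUnit (gram h x).det := by
    rw [Matrix.det_fin_two, isUnit_iff_ne_zero]
    have := (gramDet_stdVec_pos h x).ne'
    simpa only [gram, Matrix.of_apply, h.symm x (stdVec x 1) (stdVec x 0)] using this
  have htr := congrArg Matrix.trace (Matrix.nonsing_inv_mul (gram h x) hdet)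
  have hsym : gram h x 1 0 = gram h x 0 1 := h.symm _ _ _
  simp only [Matrix.trace_fin_two, Matrix.mul_apply, Fin.sum_univ_two, Matrix.one_apply_eq,
    hsym] at htr
  simp only [scalarCurvature, hr, Fin.sum_univ_two, hsym]
  linear_combination (-κ / 2) * htr

end Curvature

/-! ### Killing fields, the complex structure and the differential of `𝓕`. -/

section Vortex

variable {M : Type u} [TopologicalSpace M] [ChartedSpace Plane M] [IsManifold (𝓡 2) ∞ M]
variable {X W Z V Y : Π x : M, TangentSpace (𝓡 2) x} {f g : M → ℝ} {x : M} {h : RiemMetric M}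
  {J : Π x : M, TangentSpace (𝓡 2) x →L[ℝ] TangentSpace (𝓡 2) x}

lemma lieDerivMetric_eq (h : RiemMetric M) (hX : DiffFieldAt X x) (hV : DiffFieldAt V x)
    (hW : DiffFieldAt W x) :
    lieDerivMetric h X V W x
      = h.inner x (leviCivita h V X x) (W x) + h.inner x (V x) (leviCivita h W X x) := by
  simp only [lieDerivMetric, leviCivita_metric h hX hV hW, pair,
    ← leviCivita_torsion (h := h) hX hV, ← leviCivita_torsion (h := h) hX hW, map_sub, sub_apply]
  ring

lemma stdVec_ne_zero (x : M) : stdVec x 0 ≠ 0 := fun h0 => by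
  have : (EuclideanSpace.single (0 : Fin 2) (1 : ℝ) : Plane) = 0 := h0
  simpa using congr_fun (congrArg WithLp.ofLp this) 0

lemma inner_self_pos {v : TangentSpace (𝓡 2) x} (hv : v ≠ 0) : 0 < h.inner x v v := h.pos x v hv

/-- The vector field `J V`. -/
noncomputable def rotate (J : Π x : M, TangentSpace (𝓡 2) x →L[ℝ] TangentSpace (𝓡 2) x)
    (V : Π x : M, TangentSpace (𝓡 2) x) : Π x : M, TangentSpace (𝓡 2) x := fun x => J x (V x)

namespace IsComplexStructure

variable (hJ : IsComplexStructure h J)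
include hJ

lemma inner_left (v w : TangentSpace (𝓡 2) x) : h.inner x (J x v) w = - h.inner x v (J x w) := by
  rw [← hJ.isometry x (J x v) w, hJ.sq, map_neg, neg_apply]

lemma inner_self (v : TangentSpace (𝓡 2) x) : h.inner x (J x v) v = 0 := by
  have := hJ.inner_left v v
  rw [h.symm x v] at this
  linarith

lemma inner_self' (v : TangentSpace (𝓡 2) x) : h.inner x v (J x v) = 0 := by
  rw [h.symm, hJ.inner_self]

/-- A vector is determined by its products with `e` and `J e`. -/
lemma ext_of_ne_zero {e u v : TangentSpace (𝓡 2) x} (he : e ≠ 0)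
    (h1 : h.inner x e u = h.inner x e v) (h2 : h.inner x (J x e) u = h.inner x (J x e) v) :
    u = v := by
  have gu := gram_identity h e (J x e) u
  have gv := gram_identity h e (J x e) v
  rw [h1, h2, ← gv, hJ.isometry, hJ.inner_self', mul_zero, sub_zero] at gu
  have hp := inner_self_pos (h := h) he
  have hne := (mul_pos hp hp).ne'
  rw [← sub_eq_zero, ← smul_sub] at gu
  exact sub_eq_zero.1 ((smul_eq_zero.1 gu).resolve_left hne)

lemma smooth_rotate (hV : SmoothFieldAt V x) : SmoothFieldAt (rotate J V) x :=
  ContMDiffAt.clm_bundle_apply (F₁ := Plane) (F₂ := Plane) (hJ.smooth x) hV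

lemma rotate_add : rotate J (V + W) = rotate J V + rotate J W := by
  ext1 x; simp [rotate]

lemma rotate_smul : rotate J (f • V) = f • rotate J V := by
  ext1 x; simp [rotate]

/-- The complex structure is parallel. -/
lemma leviCivita_rotate (hX : SmoothFieldAt X x) (hW : SmoothFieldAt W x) :
    leviCivita h X (rotate J W) x = J x (leviCivita h X W x) := by
  have hT : SmoothTensorialAt
      (fun W => leviCivita h X (rotate J W) x - J x (leviCivita h X W x)) x := by
    constructor
    · intro f W hf hW
      simp only [hJ.rotate_smul, leviCivita_smul_right hf.diff hX.diff (hJ.smooth_rotate hW).diff,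
        leviCivita_smul_right hf.diff hX.diff hW.diff, map_add, map_smul]
      simp only [rotate]
      module
    · intro W W' hW hW'
      simp only [hJ.rotate_add, leviCivita_add_right hX.diff (hJ.smooth_rotate hW).diff
        (hJ.smooth_rotate hW').diff, leviCivita_add_right hX.diff hW.diff hW'.diff, map_add]
      module
  refine sub_eq_zero.1 (hT.eq_zero_of_stdVec h (fun i => sub_eq_zero.2 ?_) hW)
  set E : Π y : M, TangentSpace (𝓡 2) y := extendVec (stdVec x i) with hE
  have sE : SmoothFieldAt E x := smoothFieldAt_extendVec _
  have sJ := hJ.smooth_rotate sE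
  have hne : E x ≠ 0 := by
    rw [hE, extendVec_self]
    intro h0
    have := congrArg (fun v => coord v i) h0
    simp only [coord_stdVec, if_true] at this
    exact one_ne_zero this
  -- Differentiating `h(E, J E) = 0` and `|J E|² = |E|²` gives the components of `D_X (J E)` along
  -- `E` and `J E`.
  have e1 : pair h E (rotate J E) = fun _ => 0 := by
    ext y; exact hJ.inner_self' _
  have e2 : pair h (rotate J E) (rotate J E) = pair h E E := by
    ext y; exact hJ.isometry _ _ _
  have d1 := leviCivita_metric h hX.diff sE.diff sJ.diff
  have d2 := leviCivita_metric h hX.diff sJ.diff sJ.diff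
  have d3 := leviCivita_metric h hX.diff sE.diff sE.diff
  rw [e1, dirDeriv_const] at d1
  rw [e2, d3] at d2
  rw [h.symm x _ (E x)] at d3 d2
  rw [h.symm x (leviCivita h X (rotate J E) x)] at d2
  refine hJ.ext_of_ne_zero hne ?_ ?_
  · rw [h.symm x (E x) (J x _), hJ.inner_left]
    simp only [rotate] at d1 ⊢
    linarith
  · rw [hJ.isometry]
    simp only [rotate] at d2 ⊢
    linarith

end IsComplexStructure

lemma extDerivOne_gammaForm (hY : DiffFieldAt Y x) (hV : DiffFieldAt V x) (hW : DiffFieldAt W x) :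
    extDerivOne (gammaForm h Y) V W x
      = h.inner x (leviCivita h V Y x) (W x) - h.inner x (leviCivita h W Y x) (V x) := by
  have e1 : dirDeriv V (fun y => h.inner y (Y y) (W y)) x = _ := leviCivita_metric h hV hY hW
  have e2 : dirDeriv W (fun y => h.inner y (Y y) (V y)) x = _ := leviCivita_metric h hW hY hV
  simp only [extDerivOne, gammaForm, e1, e2, ← leviCivita_torsion (h := h) hV hW, map_sub]
  ring

lemma IsKilling.skew (hK : IsKilling h Y) (hY : DiffFieldAt Y x) (hV : SmoothFieldAt V x)
    (hW : SmoothFieldAt W x) :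
    h.inner x (leviCivita h V Y x) (W x) = - h.inner x (V x) (leviCivita h W Y x) := by
  have := hK x V W hV hW
  rw [lieDerivMetric_eq h hY hV.diff hW.diff] at this
  linarith

/-- The covariant derivative of a Killing field is a multiple of the rotation `J`. -/
lemma IsKilling.leviCivita_eq (hK : IsKilling h Y) (hJ : IsComplexStructure h J)
    (hY : DiffFieldAt Y x) (hV : DiffFieldAt V x) :
    leviCivita h V Y x = (-(faradayFunction h J Y x) / 4) • J x (V x) := by
  set e := stdVec x 0 with he
  have hne : e ≠ 0 := stdVec_ne_zero x
  have hp := inner_self_pos (h := h) hne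
  -- The endomorphism `v ↦ D_v Y` of one tangent space, skew by the Killing equation; `c` is the
  -- multiple of `J` that it equals.
  set A : TangentSpace (𝓡 2) x → TangentSpace (𝓡 2) x := fun v => leviCivita h (extendVec v) Y x
  have hA : ∀ v w, h.inner x (A v) w = - h.inner x v (A w) := fun v w => by
    have := hK.skew hY (smoothFieldAt_extendVec v) (smoothFieldAt_extendVec w)
    rwa [extendVec_self, extendVec_self] at this
  have hA0 : ∀ v, h.inner x v (A v) = 0 := fun v => by
    have := hA v v
    rw [h.symm] at this
    linarith
  have hVA : leviCivita h V Y x = A (V x) :=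
    (tensorialAt_leviCivita_left hY).pointwise hV (smoothFieldAt_extendVec _).diff
      (extendVec_self _).symm
  set c := h.inner x (A e) (J x e) / h.inner x e e with hc
  -- One factor 2 comes from `2 F = 𝓕 ω`, the other from the two equal terms of `dγ(e, J e)`.
  have hF : faradayFunction h J Y x = -4 * c := by
    have := extDerivOne_gammaForm (h := h) hY (smoothFieldAt_extendVec e).diff
      (smoothFieldAt_extendVec (J x e)).diff
    simp only [extendVec_self] at this
    have h2 := hA (J x e) e
    simp only [A] at h2
    simp only [faradayFunction, faraday, kahlerForm, ← he, this, hJ.isometry, hc, A, h2]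
    rw [h.symm x (J x e)]
    field_simp
    ring
  have hcp : h.inner x (A e) (J x e) = c * h.inner x e e := by
    rw [hc]; field_simp
  have hAe : A e = c • J x e := by
    refine hJ.ext_of_ne_zero hne ?_ ?_
    · rw [hA0, map_smul, hJ.inner_self', smul_zero]
    · rw [h.symm, hcp, map_smul, hJ.isometry, smul_eq_mul]
  have hAJ : A (J x e) = -(c • e) := by
    refine hJ.ext_of_ne_zero hne ?_ ?_
    · rw [h.symm, hA, hAe, map_smul, hJ.isometry]; simp
    · rw [hA0]; simp [hJ.inner_self]
  rw [hVA, hF, show -(-4 * c) / 4 = c by ring]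
  refine hJ.ext_of_ne_zero hne ?_ ?_
  · rw [h.symm, hA, hAe, map_smul, map_smul, h.symm x e, hJ.inner_left, smul_eq_mul, smul_eq_mul]
    ring
  · rw [h.symm, hA, hAJ, map_neg, map_smul, map_smul, hJ.isometry, h.symm x e, smul_eq_mul,
      neg_neg]

section

variable (hK : IsKilling h Y) (hJ : IsComplexStructure h J) (hY : SmoothField Y)
include hK hJ hY

/-- The definition uses a different frame at every point. Near `x` the value is also a quotient
formed with one fixed smooth field `E`, by `IsKilling.leviCivita_eq`. -/
lemma smoothFunAt_faradayFunction : SmoothFunAt (faradayFunction h J Y) x := by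
  set E : Π y : M, TangentSpace (𝓡 2) y := extendVec (stdVec x 0) with hE
  have sE : SmoothFieldAt E x := smoothFieldAt_extendVec _
  have hp : pair h E E x ≠ 0 := by
    simp only [pair, hE, extendVec_self]
    exact (inner_self_pos (stdVec_ne_zero x)).ne'
  have s1 : SmoothFunAt (fun y => (-4 * pair h (leviCivita h E Y) (rotate J E) y)
      / pair h E E y) x :=
    (contMDiffAt_const.mul ((sE.leviCivita (hY x)).pair h (hJ.smooth_rotate sE))).div₀
      (sE.pair h sE) hp
  refine s1.congr_of_eventuallyEq ?_
  filter_upwards [sE.eventually_diff, (sE.pair h sE).continuousAt.eventually_ne hp] with y h1 h2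
  simp only [pair] at h2
  simp only [pair, hK.leviCivita_eq hJ (hY y).diff h1, map_smul, smul_apply, rotate, hJ.isometry,
    smul_eq_mul]
  field_simp

/-- The vector `R(X, J X) Y`, with `X` extending `v`, is computed twice: from `D_V Y = c J V` with
`c = -𝓕/4` and `J` parallel, where only derivatives of `c` survive, and from `curvature_eq`. Pairing
with `v` isolates `X c`. -/
lemma mvfderiv_faradayFunction (v : TangentSpace (𝓡 2) x) :
    mvfderiv (𝓡 2) (faradayFunction h J Y) x v
      = 2 * scalarCurvature h x * h.inner x (Y x) (J x v) := by
  by_cases hv : v = 0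
  · simp [hv]
  have hp := inner_self_pos (h := h) hv
  set F := faradayFunction h J Y with hFdef
  have sF : SmoothFunAt F x := smoothFunAt_faradayFunction hK hJ hY
  set X : Π y : M, TangentSpace (𝓡 2) y := extendVec v with hX
  have sX : SmoothFieldAt X x := smoothFieldAt_extendVec _
  set W := rotate J X with hW
  have sW : SmoothFieldAt W x := hJ.smooth_rotate sX
  set c : M → ℝ := fun y => -(F y) / 4 with hc
  have sc : SmoothFunAt c x := sF.neg.div_const 4
  have hD : ∀ {V : Π y : M, TangentSpace (𝓡 2) y}, SmoothFieldAt V x →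
      leviCivita h V Y =ᶠ[𝓝 x] c • rotate J V := fun hV => by
    filter_upwards [hV.eventually_diff] with y hy
    exact hK.leviCivita_eq hJ (hY y).diff hy
  have hXx : X x = v := extendVec_self v
  have hWx : W x = J x v := by simp only [hW, rotate, hXx]
  have r1 : curvature h X W Y x = dirDeriv X c x • J x (W x) - dirDeriv W c x • J x (X x) := by
    simp only [curvature]
    rw [leviCivita_congr (h := h) (EventuallyEq.refl _ X) (hD sW),
      leviCivita_congr (h := h) (EventuallyEq.refl _ W) (hD sX), (hD (sX.bracket sW)).eq_of_nhds,
      leviCivita_smul_right sc.diff sX.diff (hJ.smooth_rotate sW).diff,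
      leviCivita_smul_right sc.diff sW.diff (hJ.smooth_rotate sX).diff,
      hJ.leviCivita_rotate sX sW, hJ.leviCivita_rotate sW sX]
    simp only [Pi.smul_apply', rotate, ← leviCivita_torsion (h := h) sX.diff sW.diff, map_sub]
    module
  rw [curvature_eq h sX sW (hY x), hWx, hXx, hJ.sq] at r1
  have r2 := congrArg (fun u => h.inner x u v) r1
  simp only [map_sub, map_smul, sub_apply, smul_apply, map_neg, neg_apply, smul_eq_mul,
    hJ.inner_self] at r2
  have r3 : dirDeriv X c x = - (1 / 4) * mvfderiv (𝓡 2) F x v := by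
    have : c = (fun _ => (-(1 / 4) : ℝ)) * F := by
      ext y; simp only [hc, Pi.mul_apply]; ring
    rw [this, dirDeriv_mul mdifferentiableAt_const sF.diff, dirDeriv_const]
    simp only [dirDeriv, hXx]
    ring
  rw [r3, h.symm x (J x v)] at r2
  have r4 : h.inner x v v * (mvfderiv (𝓡 2) F x v
      - 2 * scalarCurvature h x * h.inner x (Y x) (J x v)) = 0 := by
    linarith
  exact sub_eq_zero.1 ((mul_eq_zero.1 r4).resolve_left hp.ne')

lemma mvfderiv_pair_self (v : TangentSpace (𝓡 2) x) :
    mvfderiv (𝓡 2) (pair h Y Y) x v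
      = -(faradayFunction h J Y x / 2) * h.inner x (Y x) (J x v) := by
  have sX := (smoothFieldAt_extendVec v).diff
  have := leviCivita_metric h sX (hY x).diff (hY x).diff
  simp only [hK.leviCivita_eq hJ (hY x).diff sX, dirDeriv, extendVec_self, map_smul, smul_apply,
    smul_eq_mul, h.symm x (J x v)] at this
  rw [this]
  ring

end

end Vortex

/-! ### Naturality of the connection and curvature under local diffeomorphisms. -/

section Pullback

variable {M : Type u} [TopologicalSpace M] [ChartedSpace Plane M] [IsManifold (𝓡 2) ∞ M]
variable {N : Type u} [TopologicalSpace N] [ChartedSpace Plane N] [IsManifold (𝓡 2) ∞ N]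
variable {X W Z V : Π x : M, TangentSpace (𝓡 2) x} {f : M → ℝ} {h : RiemMetric M} {k : RiemMetric N}
  {p : N → M} {y : N}

/-- The pullback of a vector field along a local diffeomorphism. -/
noncomputable abbrev pull (p : N → M) (V : Π x : M, TangentSpace (𝓡 2) x) :
    Π y : N, TangentSpace (𝓡 2) y :=
  VectorField.mpullback (𝓡 2) (𝓡 2) p V

variable (hp : IsLocalDiffeomorph (𝓡 2) (𝓡 2) ∞ p)
include hp

lemma isInvertible_mfderiv (y : N) : (mfderiv (𝓡 2) (𝓡 2) p y).IsInvertible :=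
  ⟨hp.mfderivToContinuousLinearEquiv (by simp) y, hp.mfderivToContinuousLinearEquiv_coe (by simp) y⟩

lemma mfderiv_pull : mfderiv (𝓡 2) (𝓡 2) p y (pull p V y) = V (p y) := by
  obtain ⟨e, he⟩ := isInvertible_mfderiv hp y
  simp [pull, VectorField.mpullback_apply, ← he]

lemma pull_eq_iff {v : TangentSpace (𝓡 2) y} :
    pull p V y = v ↔ V (p y) = mfderiv (𝓡 2) (𝓡 2) p y v := by
  obtain ⟨e, he⟩ := isInvertible_mfderiv hp y
  simp only [pull, VectorField.mpullback_apply, ← he, ContinuousLinearMap.inverse_equiv]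
  exact e.symm_apply_eq

lemma DiffFieldAt.pull (hV : DiffFieldAt V (p y)) : DiffFieldAt (pull p V) y :=
  MDifferentiableAt.mpullback_vectorField (n := ∞) hV (hp.contMDiff y) (isInvertible_mfderiv hp y)
    (by norm_cast)

lemma SmoothFieldAt.pull (hV : SmoothFieldAt V (p y)) : SmoothFieldAt (pull p V) y :=
  ContMDiffAt.mpullback_vectorField_preimage (n := ∞) (m := ∞) hV (hp.contMDiff y)
    (isInvertible_mfderiv hp y) (by simp)

lemma dirDeriv_pull (hf : DiffFunAt f (p y)) :
    dirDeriv (RealVortex.pull p V) (f ∘ p) y = dirDeriv V f (p y) := by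
  have hd : MDifferentiableAt (𝓡 2) (𝓡 2) p y := (hp.contMDiff y).mdifferentiableAt (by simp)
  have : mfderiv (𝓡 2) 𝓘(ℝ, ℝ) (f ∘ p) y
      = (mfderiv (𝓡 2) 𝓘(ℝ, ℝ) f (p y)).comp (mfderiv (𝓡 2) (𝓡 2) p y) := mfderiv_comp y hf hd
  have h2 := mfderiv_pull (V := V) (y := y) hp
  simp only [dirDeriv, mvfderiv]
  rw [this, ← h2]
  rfl

lemma bracket_pull (hV : DiffFieldAt V (p y)) (hW : DiffFieldAt W (p y)) :
    bracket (RealVortex.pull p V) (RealVortex.pull p W) y = RealVortex.pull p (bracket V W) y :=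
  (VectorField.mpullback_mlieBracket (n := ∞) hV hW (hp.contMDiff y)
    (by rw [minSmoothness_of_isRCLikeNormedField]; norm_cast)).symm

variable (hk : IsPullbackMetric p h k)
include hk

lemma inner_pull (v w : Π x : M, TangentSpace (𝓡 2) x) :
    k.inner y (RealVortex.pull p v y) (RealVortex.pull p w y) = h.inner (p y) (v (p y)) (w (p y)) := by
  rw [hk, mfderiv_pull hp, mfderiv_pull hp]

lemma pair_pull : pair k (RealVortex.pull p V) (RealVortex.pull p W) = pair h V W ∘ p :=
  funext fun _ => inner_pull hp hk V W

lemma koszul_pull (hX : DiffFieldAt X (p y)) (hW : DiffFieldAt W (p y))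
    (hZ : DiffFieldAt Z (p y)) :
    koszul k (RealVortex.pull p X) (RealVortex.pull p W) (RealVortex.pull p Z) y
      = koszul h X W Z (p y) := by
  simp only [koszul, pair_pull hp hk, dirDeriv_pull hp (hX.pair h hW),
    dirDeriv_pull hp (hX.pair h hZ), dirDeriv_pull hp (hW.pair h hZ)]
  simp only [pair, bracket_pull hp hX hW, bracket_pull hp hX hZ, bracket_pull hp hW hZ,
    inner_pull hp hk]

lemma exists_pull (w : TangentSpace (𝓡 2) y) :
    ∃ V : Π x : M, TangentSpace (𝓡 2) x, SmoothFieldAt V (p y) ∧ RealVortex.pull p V y = w :=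
  ⟨extendVec (mfderiv (𝓡 2) (𝓡 2) p y w), smoothFieldAt_extendVec _,
    (pull_eq_iff hp).2 (extendVec_self _)⟩

lemma leviCivita_pull (hX : DiffFieldAt X (p y)) (hW : DiffFieldAt W (p y)) :
    leviCivita k (RealVortex.pull p X) (RealVortex.pull p W) y
      = RealVortex.pull p (leviCivita h X W) y := by
  refine inner_left_ext (h := k) fun w => ?_
  obtain ⟨Z, hZ, rfl⟩ := exists_pull hp hk w
  rw [inner_leviCivita k (hX.pull hp) (hW.pull hp) (hZ.diff.pull hp), inner_pull hp hk,
    inner_leviCivita h hX hW hZ.diff, koszul_pull hp hk hX hW hZ.diff]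

lemma eventually_leviCivita_pull (hX : SmoothFieldAt X (p y)) (hW : SmoothFieldAt W (p y)) :
    leviCivita k (RealVortex.pull p X) (RealVortex.pull p W) =ᶠ[𝓝 y]
      RealVortex.pull p (leviCivita h X W) := by
  filter_upwards [(hp.contMDiff y).continuousAt.eventually hX.eventually_diff,
    (hp.contMDiff y).continuousAt.eventually hW.eventually_diff] with z h1 h2
  exact leviCivita_pull hp hk h1 h2

lemma curvature_pull (hX : SmoothFieldAt X (p y)) (hW : SmoothFieldAt W (p y))
    (hZ : SmoothFieldAt Z (p y)) :
    curvature k (RealVortex.pull p X) (RealVortex.pull p W) (RealVortex.pull p Z) y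
      = RealVortex.pull p (curvature h X W Z) y := by
  have hb : bracket (RealVortex.pull p X) (RealVortex.pull p W) =ᶠ[𝓝 y]
      RealVortex.pull p (bracket X W) := by
    filter_upwards [(hp.contMDiff y).continuousAt.eventually hX.eventually_diff,
      (hp.contMDiff y).continuousAt.eventually hW.eventually_diff] with z h1 h2
    exact bracket_pull hp h1 h2
  simp only [curvature]
  rw [leviCivita_congr (h := k) (EventuallyEq.refl _ (RealVortex.pull p X))
      (eventually_leviCivita_pull hp hk hW hZ),
    leviCivita_congr (h := k) (EventuallyEq.refl _ (RealVortex.pull p W))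
      (eventually_leviCivita_pull hp hk hX hZ),
    leviCivita_congr (h := k) hb (EventuallyEq.refl _ (RealVortex.pull p Z)),
    leviCivita_pull hp hk hX.diff (hW.leviCivita hZ).diff,
    leviCivita_pull hp hk hW.diff (hX.leviCivita hZ).diff,
    leviCivita_pull hp hk (hX.bracket hW).diff hZ.diff]
  simp only [RealVortex.pull, VectorField.mpullback_apply, curvature, map_sub]

/-- The standard bases at `y` and `p y` need not correspond, so the traces cannot be compared
directly. The curvature tensors can: by `curvature_eq` both sides appear as the factor of the same
nonzero Gram determinant. -/
lemma scalarCurvature_pull (y : N) : scalarCurvature k y = scalarCurvature h (p y) := by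
  have s0 := smoothFieldAt_extendVec (stdVec (p y) 0)
  have s1 := smoothFieldAt_extendVec (stdVec (p y) 1)
  have e1 := curvature_eq k (s0.pull hp) (s1.pull hp) (s1.pull hp)
  rw [curvature_pull hp hk s0 s1 s1] at e1
  have e2 := curvature_eq h s0 s1 s1
  have e3 := congrArg (fun v => k.inner y v (RealVortex.pull p (extendVec (stdVec (p y) 0)) y)) e1
  have e4 := congrArg (fun v => h.inner (p y) v (extendVec (stdVec (p y) 0) (p y))) e2
  simp only [inner_pull hp hk, map_smul, map_sub, sub_apply, smul_apply, smul_eq_mul,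
    extendVec_self] at e3 e4
  rw [e4] at e3
  have hd := (gramDet_stdVec_pos h (p y)).ne'
  rw [h.symm (p y) (stdVec (p y) 1) (stdVec (p y) 0)] at e3
  rw [mul_comm (h.inner (p y) (stdVec (p y) 0) (stdVec (p y) 0))] at hd
  have := mul_right_cancel₀ hd e3
  linarith

end Pullback

/-! ### Moment maps as soliton potentials. -/

section Soliton

variable {M : Type u} [TopologicalSpace M] [ChartedSpace Plane M] [IsManifold (𝓡 2) ∞ M]
variable {N : Type u} [TopologicalSpace N] [ChartedSpace Plane N] [IsManifold (𝓡 2) ∞ N]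
variable {h : RiemMetric M} {k : RiemMetric N} {Y : Π x : M, TangentSpace (𝓡 2) x}
  {J : Π x : M, TangentSpace (𝓡 2) x →L[ℝ] TangentSpace (𝓡 2) x} {p : N → M}

/-- The gradient of the potential `-2 s μ` is conformal, with factor the Faraday function. -/
lemma leviCivita_rotate_killing {x : M} {V : Π x : M, TangentSpace (𝓡 2) x}
    (hK : IsKilling h Y) (hJ : IsComplexStructure h J) (hY : SmoothField Y)
    (hV : SmoothFieldAt V x) (c : ℝ) :
    leviCivita h V ((fun _ : M => c) • rotate J Y) x = (c * faradayFunction h J Y x / 4) • V x := by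
  rw [leviCivita_smul_right mdifferentiableAt_const hV.diff (hJ.smooth_rotate (hY x)).diff,
    dirDeriv_const, hJ.leviCivita_rotate hV (hY x), hK.leviCivita_eq hJ (hY x).diff hV.diff,
    map_smul, hJ.sq]
  module

/-- The gradient of `-2sμ` is the pullback of `2s JY`, whose covariant derivative is `s𝓕/2` times
the identity. Hence `(1/2) R k + (1/2) 𝓛 k = (1/2)(R + s𝓕) k`. -/
lemma isSteadyGradientRicciSoliton_of_isMomentMap (hK : IsKilling h Y)
    (hJ : IsComplexStructure h J) (hY : SmoothField Y)
    (hp : IsLocalDiffeomorph (𝓡 2) (𝓡 2) ∞ p) (hk : IsPullbackMetric p h k) {s : ℝ}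
    (hs : ∀ x, scalarCurvature h x + s * faradayFunction h J Y x = 0) {μ : N → ℝ}
    (hμ : IsMomentMap p h J Y μ) :
    IsSteadyGradientRicciSoliton k (fun y => -2 * s * μ y) := by
  set G : Π x : M, TangentSpace (𝓡 2) x := (fun _ : M => 2 * s) • rotate J Y with hG
  have sG : SmoothField G := fun x => (hJ.smooth_rotate (hY x)).smul contMDiffAt_const
  refine ⟨contMDiff_const.mul hμ.1, pull p G, fun y => (sG (p y)).pull hp, fun y v => ?_,
    fun y V W hV hW => ?_⟩
  · have hm : DiffFunAt μ y := (hμ.1 y).mdifferentiableAt (by simp)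
    have e : (fun y => -2 * s * μ y) = (fun _ => -2 * s) * μ := rfl
    rw [e, mvfderiv_mul mdifferentiableAt_const hm, mvfderiv_const, smul_zero, add_zero,
      smul_apply, hμ.2 y v, hk, mfderiv_pull hp]
    simp only [hG, hodgeStar, gammaForm, Pi.smul_apply', rotate, map_smul, smul_apply, smul_eq_mul,
      hJ.inner_left, neg_apply, ContinuousLinearMap.comp_apply]
    ring
  · have hD : ∀ {V : Π y : N, TangentSpace (𝓡 2) y}, SmoothFieldAt V y →
        leviCivita k V (pull p G) y = (s * faradayFunction h J Y (p y) / 2) • V y := by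
      intro V hV
      -- A field on `N` need not be a pullback, but the derivative in its direction depends only on
      -- its value at `y`.
      obtain ⟨V', hV', e⟩ := exists_pull hp hk (V y)
      have dG := ((sG (p y)).pull hp).diff
      rw [(tensorialAt_leviCivita_left dG).pointwise hV.diff (hV'.pull hp).diff e.symm,
        leviCivita_pull hp hk hV'.diff (sG (p y)).diff, ← e, pull_eq_iff hp, hG,
        leviCivita_rotate_killing hK hJ hY hV', map_smul, mfderiv_pull hp]
      congr 1
      ring
    rw [lieDerivMetric_eq k ((sG (p y)).pull hp).diff hV.diff hW.diff, hD hV, hD hW,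
      scalarCurvature_pull hp hk, pair]
    simp only [map_smul, smul_apply, smul_eq_mul]
    linear_combination (1 / 2 * k.inner y (V y) (W y)) * hs (p y)

end Soliton

/-! ### Uniqueness for the linear equation `dg = g η`. -/

section Linear

variable {M : Type u} [TopologicalSpace M] [ChartedSpace Plane M] [IsManifold (𝓡 2) ∞ M]
variable {g : M → ℝ} {η : Π x : M, TangentSpace (𝓡 2) x →L[ℝ] ℝ}

/-- A solution of `dg = g η` that vanishes at a point vanishes nearby. -/
lemma eventually_eq_zero_of_mvfderiv_eq {x : M} (hg : ∀ y, DiffFunAt g y)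
    (hη : ∀ V : Π y : M, TangentSpace (𝓡 2) y, SmoothFieldAt V x →
      SmoothFunAt (fun y => η y (V y)) x)
    (hd : ∀ y v, mvfderiv (𝓡 2) g y v = g y * η y v) (h0 : g x = 0) : ∀ᶠ y in 𝓝 x, g y = 0 := by
  set t := trivializationAt Plane (fun y : M => TangentSpace (𝓡 2) y) x with ht
  set φ := extChartAt (𝓡 2) x with hφ
  set a : Plane → M → ℝ := fun w y => η y (t.symmL ℝ y w) with ha
  have hx : x ∈ t.baseSet := FiberBundle.mem_baseSet_trivializationAt' x
  have hac : ∀ w, ContinuousAt (a w) x := fun w => by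
    -- Near `x` this extension is the field with constant components `w` in the trivialization, so
    -- `a w` is `η` applied to a smooth field.
    have s1 := smoothFieldAt_extendVec (t.symm x w : TangentSpace (𝓡 2) x)
    have s2 := (hη _ s1).continuousAt
    refine s2.congr ?_
    filter_upwards [t.open_baseSet.mem_nhds hx] with y hy
    simp only [ha, extendVec, FiberBundle.extend, ← ht]
    rw [t.apply_mk_symm hx, Trivialization.symmL_apply _ hy]
  have haw : ∀ w y, a w y = w 0 * a (EuclideanSpace.single 0 1) y
      + w 1 * a (EuclideanSpace.single 1 1) y := fun w y => by
    have hw : w = w 0 • EuclideanSpace.single (0 : Fin 2) (1 : ℝ)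
        + w 1 • EuclideanSpace.single (1 : Fin 2) (1 : ℝ) := by
      ext i; fin_cases i <;> simp
    conv_lhs => rw [hw]
    simp only [ha, map_add, map_smul, smul_eq_mul]
  obtain ⟨C, hC⟩ : ∃ C : ℝ, ∀ᶠ y in 𝓝 x, |a (EuclideanSpace.single 0 1) y| ≤ C ∧
      |a (EuclideanSpace.single 1 1) y| ≤ C := by
    refine ⟨max (|a (EuclideanSpace.single 0 1) x| + 1) (|a (EuclideanSpace.single 1 1) x| + 1), ?_⟩
    filter_upwards [(hac (EuclideanSpace.single 0 1)).abs.eventually_lt continuousAt_const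
        (lt_add_one _), (hac (EuclideanSpace.single 1 1)).abs.eventually_lt continuousAt_const
        (lt_add_one _)] with y h1 h2
    exact ⟨h1.le.trans (le_max_left _ _), h2.le.trans (le_max_right _ _)⟩
  have hC' : ∀ᶠ z in 𝓝 (φ x), z ∈ φ.target ∧ |a (EuclideanSpace.single 0 1) (φ.symm z)| ≤ C ∧
      |a (EuclideanSpace.single 1 1) (φ.symm z)| ≤ C := by
    have hc := continuousAt_extChartAt_symm (I := 𝓡 2) x
    rw [ContinuousAt, extChartAt_to_inv] at hc
    have ht : ∀ᶠ z in 𝓝 (φ x), z ∈ φ.target := extChartAt_target_mem_nhds (I := 𝓡 2) x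
    exact ht.and (hc.eventually hC)
  obtain ⟨r, hr, hball⟩ := Metric.eventually_nhds_iff_ball.1 hC'
  have hderiv : ∀ z ∈ φ.target, HasFDerivAt (g ∘ φ.symm)
      ((g (φ.symm z)) • (η (φ.symm z)).comp (t.symmL ℝ (φ.symm z)) : Plane →L[ℝ] ℝ) z := by
    intro z hz
    have hr : Set.range (𝓡 2) = Set.univ := (𝓡 2).range_eq_univ
    have m1 := mdifferentiableWithinAt_extChartAt_symm (I := 𝓡 2) hz
    have e1 := TangentBundle.symmL_trivializationAt (I := 𝓡 2) (𝕜 := ℝ) (x₀ := x)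
      (x := φ.symm z) (by simpa [hφ] using φ.map_target hz)
    rw [← hφ, φ.right_inv hz, hr, mfderivWithin_univ] at e1
    rw [hr, mdifferentiableWithinAt_univ] at m1
    have m2 := ((hg (φ.symm z)).hasMFDerivAt.comp z m1.hasMFDerivAt).hasFDerivAt
    refine m2.congr_fderiv ?_
    ext w
    have e2 : t.symmL ℝ (φ.symm z) w = mfderiv 𝓘(ℝ, Plane) (𝓡 2) φ.symm z w :=
      DFunLike.congr_fun e1 w
    exact (hd (φ.symm z) _).trans (congrArg (fun v => g (φ.symm z) * η (φ.symm z) v) e2.symm)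
  have hnear : ∀ᶠ y in 𝓝 x, y ∈ φ.source ∧ φ y ∈ Metric.ball (φ x) r :=
    Eventually.and (extChartAt_source_mem_nhds (I := 𝓡 2) x)
      ((continuousAt_extChartAt (I := 𝓡 2) x).eventually (Metric.ball_mem_nhds _ hr))
  filter_upwards [hnear] with y ⟨hy1, hy2⟩
  -- Along the chart segment from `φ x` to `φ y`, which stays in the ball, `g` solves a scalar
  -- linear equation with bounded coefficient and initial value 0; Grönwall's inequality forces it
  -- to vanish.
  set w := φ y - φ x with hw
  have hseg : ∀ s ∈ Set.Icc (0 : ℝ) 1, φ x + s • w ∈ Metric.ball (φ x) r := by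
    intro s hs
    rw [mem_ball_iff_norm, add_sub_cancel_left, norm_smul, Real.norm_of_nonneg hs.1]
    rw [mem_ball_iff_norm, ← hw] at hy2
    exact (mul_le_of_le_one_left (norm_nonneg _) hs.2).trans_lt hy2
  have hu : ∀ s ∈ Set.Icc (0 : ℝ) 1, HasDerivAt (fun s : ℝ => g (φ.symm (φ x + s • w)))
      (g (φ.symm (φ x + s • w)) * a w (φ.symm (φ x + s • w))) s := by
    intro s hs
    have h1 := hderiv _ (hball _ (hseg s hs)).1
    have h2 : HasDerivAt (fun s : ℝ => φ x + s • w) w s := by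
      simpa using ((hasDerivAt_id s).smul_const w).const_add (φ x)
    exact h1.comp_hasDerivAt s h2
  have hfin := eq_zero_of_abs_deriv_le_mul_abs_self_of_eq_zero_right
    (f := fun s : ℝ => g (φ.symm (φ x + s • w))) (a := 0) (b := 1) (K := (|w 0| + |w 1|) * C)
    (fun s hs => (hu s hs).continuousAt.continuousWithinAt)
    (fun s hs => (hu s (Set.Ico_subset_Icc_self hs)).hasDerivWithinAt)
    (by simp [hφ, h0]) (fun s hs => ?_) 1 (by simp)
  · simpa [hw, φ.left_inv hy1] using hfin
  · obtain ⟨-, b0, b1⟩ := hball _ (hseg s (Set.Ico_subset_Icc_self hs))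
    rw [norm_mul, mul_comm]
    refine mul_le_mul_of_nonneg_right ?_ (norm_nonneg _)
    rw [haw w, Real.norm_eq_abs]
    refine (abs_add_le _ _).trans ?_
    rw [abs_mul, abs_mul, add_mul]
    gcongr

/-- On a connected surface, a solution of `dg = g η` that vanishes at a point vanishes
identically. -/
lemma eq_zero_of_mvfderiv_eq [ConnectedSpace M] (hg : ∀ y, DiffFunAt g y)
    (hη : ∀ x, ∀ V : Π y : M, TangentSpace (𝓡 2) y, SmoothFieldAt V x →
      SmoothFunAt (fun y => η y (V y)) x)
    (hd : ∀ y v, mvfderiv (𝓡 2) g y v = g y * η y v) {x : M} (h0 : g x = 0) (y : M) : g y = 0 := by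
  have hc : Continuous g := continuous_iff_continuousAt.2 fun y => (hg y).continuousAt
  have hcl : IsClopen {y | g y = 0} :=
    ⟨isClosed_eq hc continuous_const,
      isOpen_iff_mem_nhds.2 fun y hy => eventually_eq_zero_of_mvfderiv_eq hg (hη y) hd hy⟩
  have := hcl.eq_univ ⟨x, h0⟩
  exact (Set.mem_univ y : y ∈ Set.univ) |> fun hy => by rwa [← this] at hy

lemma eq_of_mvfderiv_eq_zero [ConnectedSpace M] (hg : ∀ y, DiffFunAt g y)
    (hd : ∀ y v, mvfderiv (𝓡 2) g y v = 0) (x y : M) : g y = g x := by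
  have := eq_zero_of_mvfderiv_eq (g := fun y => g y - g x) (η := fun _ => 0) (x := x)
    (fun y => (hg y).sub mdifferentiableAt_const) (fun x V hV => by simpa using contMDiffAt_const)
    (fun y v => by
      rw [mvfderiv_fun_sub (hg y) mdifferentiableAt_const, mvfderiv_const]
      simp [hd]) (by simp) y
  linarith

end Linear

/-! ### The system `dR = 2ε𝓕η`, `d𝓕 = 2Rη` and its consequences. -/

section Consequences

variable {M : Type u} [TopologicalSpace M] [ChartedSpace Plane M] [IsManifold (𝓡 2) ∞ M]
  {h : RiemMetric M} {J : Π x : M, TangentSpace (𝓡 2) x →L[ℝ] TangentSpace (𝓡 2) x}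
  {Y : Π x : M, TangentSpace (𝓡 2) x} {ε τ : ℝ}

lemma mvfderiv_linear_comb {f g : M → ℝ} {x : M} (hf : DiffFunAt f x) (hg : DiffFunAt g x)
    (a b : ℝ) (v : TangentSpace (𝓡 2) x) :
    mvfderiv (𝓡 2) (fun y => a * f y + b * g y) x v
      = a * mvfderiv (𝓡 2) f x v + b * mvfderiv (𝓡 2) g x v := by
  have hc : ∀ c : ℝ, DiffFunAt (fun _ : M => c) x := fun c => mdifferentiableAt_const
  have ha : DiffFunAt (fun y => a * f y) x := (hc a).mul hf
  have hb : DiffFunAt (fun y => b * g y) x := (hc b).mul hg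
  rw [mvfderiv_fun_add ha hb, mvfderiv_fun_mul (hc a) hf,
    mvfderiv_fun_mul (hc b) hg, mvfderiv_const, mvfderiv_const]
  simp

lemma isFlat_of_scalarCurvature_eq_zero (hR : ∀ x, scalarCurvature h x = 0) : IsFlat h := by
  intro x X W Z hX hW hZ
  rw [curvature_eq h hX hW hZ, hR]
  simp

/-- This covers the flat case, where `-⋆γ` need not have a global primitive. -/
lemma isSteadyGradientRicciSoliton_zero (hR : ∀ x, scalarCurvature h x = 0) :
    IsSteadyGradientRicciSoliton h (fun _ => 0) := by
  refine ⟨contMDiff_const, 0, fun x => ?_, fun x v => ?_, fun x V W hV hW => ?_⟩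
  · exact (contMDiff_zeroSection ℝ (fun x : M => TangentSpace (𝓡 2) x)).contMDiffAt
  · simp [mvfderiv_const]
  · simp [hR, lieDerivMetric, dirDeriv, pair, bracket]

/-- The one-form `h(Y, J ·)`, that is, `- ⋆ γ`. -/
noncomputable def momentForm (h : RiemMetric M)
    (J : Π x : M, TangentSpace (𝓡 2) x →L[ℝ] TangentSpace (𝓡 2) x)
    (Y : Π x : M, TangentSpace (𝓡 2) x) (x : M) : TangentSpace (𝓡 2) x →L[ℝ] ℝ :=
  (h.inner x (Y x)).comp (J x)

lemma smooth_momentForm (hJ : IsComplexStructure h J) (hY : SmoothField Y) (x : M)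
    (V : Π y : M, TangentSpace (𝓡 2) y) (hV : SmoothFieldAt V x) :
    SmoothFunAt (fun y => momentForm h J Y y (V y)) x :=
  (hY x).pair h (hJ.smooth_rotate hV)

lemma momentForm_ne_zero (hJ : IsComplexStructure h J) {x : M} (hx : Y x ≠ 0) :
    momentForm h J Y x (J x (Y x)) ≠ 0 := by
  simp only [momentForm, ContinuousLinearMap.comp_apply, hJ.sq, map_neg]
  exact neg_ne_zero.2 (inner_self_pos hx).ne'

lemma faradayFunction_eq_zero_of_field (hJ : IsComplexStructure h J) (hK : IsKilling h Y)
    (hY : SmoothField Y) (h0 : ∀ x, Y x = 0) (x : M) : faradayFunction h J Y x = 0 := by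
  have sE := smoothFieldAt_extendVec (stdVec x 0)
  have e1 := hK.leviCivita_eq hJ (hY x).diff sE.diff
  -- Since `Y = 0 • Y`, the Leibniz rule gives `D_E Y = 0`, and `J` is injective.
  have e2 := leviCivita_smul_right (h := h) (f := fun _ : M => (0 : ℝ)) mdifferentiableAt_const
    sE.diff (hY x).diff
  have e3 : (fun _ : M => (0 : ℝ)) • Y = Y := by ext1 y; simp [h0]
  rw [e3, dirDeriv_const, zero_smul, zero_smul, add_zero, e1, extendVec_self] at e2
  have hne : J x (stdVec x 0) ≠ 0 := fun hz => by
    have := hJ.sq x (stdVec x 0)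
    rw [hz, map_zero, zero_eq_neg] at this
    exact stdVec_ne_zero x this
  have := (smul_eq_zero.1 e2).resolve_right hne
  linarith

namespace IsRealVortex

variable (hsol : IsRealVortex h Y ε τ) (hJ : IsComplexStructure h J)
include hsol

lemma scalarCurvature_eq (x : M) : scalarCurvature h x = τ + (-4 * ε) * pair h Y Y x := by
  have := hsol.vortex x
  simp only [pair]
  linarith

lemma smooth_scalarCurvature (x : M) : SmoothFunAt (scalarCurvature h) x := by
  rw [funext hsol.scalarCurvature_eq]
  exact contMDiffAt_const.add (contMDiffAt_const.mul ((hsol.smooth x).pair h (hsol.smooth x)))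

include hJ

lemma smooth_faraday (x : M) : SmoothFunAt (faradayFunction h J Y) x :=
  smoothFunAt_faradayFunction hsol.killing hJ hsol.smooth

lemma mvfderiv_faraday (x : M) (v : TangentSpace (𝓡 2) x) :
    mvfderiv (𝓡 2) (faradayFunction h J Y) x v
      = 2 * scalarCurvature h x * momentForm h J Y x v :=
  mvfderiv_faradayFunction hsol.killing hJ hsol.smooth v

lemma mvfderiv_scalarCurvature (x : M) (v : TangentSpace (𝓡 2) x) :
    mvfderiv (𝓡 2) (scalarCurvature h) x v
      = 2 * ε * faradayFunction h J Y x * momentForm h J Y x v := by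
  have e : scalarCurvature h = fun y => τ * (fun _ => 1 : M → ℝ) y + (-4 * ε) * pair h Y Y y := by
    ext y; rw [hsol.scalarCurvature_eq]; ring
  rw [e, mvfderiv_linear_comb mdifferentiableAt_const
    ((hsol.smooth x).pair h (hsol.smooth x)).diff, mvfderiv_const,
    mvfderiv_pair_self hsol.killing hJ hsol.smooth]
  simp only [momentForm, ContinuousLinearMap.comp_apply, zero_apply]
  ring

/-- For `ε = 1` and `s² = 1` the bracket equals `s (R + s𝓕)`, which makes `R + s𝓕` a solution of a
linear equation. -/
lemma mvfderiv_add_mul (x : M) (s : ℝ) (v : TangentSpace (𝓡 2) x) :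
    mvfderiv (𝓡 2) (fun y => scalarCurvature h y + s * faradayFunction h J Y y) x v
      = 2 * (ε * faradayFunction h J Y x + s * scalarCurvature h x) * momentForm h J Y x v := by
  have := mvfderiv_linear_comb (hsol.smooth_scalarCurvature x).diff (hsol.smooth_faraday hJ x).diff
    1 s v
  simp only [one_mul] at this
  rw [this, hsol.mvfderiv_scalarCurvature hJ, hsol.mvfderiv_faraday hJ]
  ring

lemma diff_add_mul (x : M) (s : ℝ) :
    DiffFunAt (fun y => scalarCurvature h y + s * faradayFunction h J Y y) x :=
  (hsol.smooth_scalarCurvature x).diff.add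
    (mdifferentiableAt_const.mul (hsol.smooth_faraday hJ x).diff)

/-- The conserved quantity `R² - ε 𝓕²`. -/
lemma exists_conserved [ConnectedSpace M] :
    ∃ σ : ℝ, ∀ x, scalarCurvature h x ^ 2 - ε * faradayFunction h J Y x ^ 2 = σ := by
  obtain ⟨x₀⟩ := (inferInstance : Nonempty M)
  refine ⟨_, eq_of_mvfderiv_eq_zero
    (g := fun x => scalarCurvature h x ^ 2 - ε * faradayFunction h J Y x ^ 2) (fun y => ?_)
    (fun y v => ?_) x₀⟩
  · have hR := (hsol.smooth_scalarCurvature y).diff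
    have hF := (hsol.smooth_faraday hJ y).diff
    simp only [sq]
    exact (hR.mul hR).sub (mdifferentiableAt_const.mul (hF.mul hF))
  · have hR := (hsol.smooth_scalarCurvature y).diff
    have hF := (hsol.smooth_faraday hJ y).diff
    have e := mvfderiv_linear_comb (hR.mul hR) (hF.mul hF) 1 (-ε) v
    have e2 : (fun x => scalarCurvature h x ^ 2 - ε * faradayFunction h J Y x ^ 2)
        = fun x => 1 * (scalarCurvature h * scalarCurvature h) x
          + -ε * (faradayFunction h J Y * faradayFunction h J Y) x := by
      ext x; simp only [Pi.mul_apply]; ring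
    rw [e2]
    refine e.trans ?_
    rw [mvfderiv_mul hR hR, mvfderiv_mul hF hF]
    simp only [add_apply, smul_apply, smul_eq_mul, hsol.mvfderiv_scalarCurvature hJ,
      hsol.mvfderiv_faraday hJ]
    ring

/-- For `ε = 1`, a function `R ± 𝓕` with a zero vanishes identically. -/
lemma add_mul_eq_zero [ConnectedSpace M] (hε : ε = 1) {s : ℝ} (hs : s = 1 ∨ s = -1) {x : M}
    (h0 : scalarCurvature h x + s * faradayFunction h J Y x = 0) (y : M) :
    scalarCurvature h y + s * faradayFunction h J Y y = 0 := by
  have hss : s * s = 1 := by rcases hs with rfl | rfl <;> norm_num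
  refine eq_zero_of_mvfderiv_eq (η := fun x => (2 * s) • momentForm h J Y x) (x := x)
    (fun y => hsol.diff_add_mul hJ y s)
    (fun x V hV => contMDiffAt_const.mul (smooth_momentForm hJ hsol.smooth x V hV))
    (fun y v => ?_) h0 y
  rw [hsol.mvfderiv_add_mul hJ, hε]
  simp only [smul_apply, smul_eq_mul]
  linear_combination (-2 * faradayFunction h J Y y * momentForm h J Y y v) * hss

/-- For `ε = 1` and `R ± 𝓕 = 0`, if `R` has a zero then it vanishes identically. -/
lemma scalarCurvature_eq_zero [ConnectedSpace M] (hε : ε = 1) {s : ℝ} (hs : s = 1 ∨ s = -1)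
    (hz : ∀ x, scalarCurvature h x + s * faradayFunction h J Y x = 0) {x : M}
    (h0 : scalarCurvature h x = 0) (y : M) : scalarCurvature h y = 0 := by
  have hss : s * s = 1 := by rcases hs with rfl | rfl <;> norm_num
  refine eq_zero_of_mvfderiv_eq (η := fun x => (-2 * s) • momentForm h J Y x) (x := x)
    (fun y => (hsol.smooth_scalarCurvature y).diff)
    (fun x V hV => contMDiffAt_const.mul (smooth_momentForm hJ hsol.smooth x V hV))
    (fun y v => ?_) h0 y
  rw [hsol.mvfderiv_scalarCurvature hJ, hε]
  simp only [smul_apply, smul_eq_mul]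
  linear_combination (2 * s * momentForm h J Y y v) * hz y
    - (2 * faradayFunction h J Y y * momentForm h J Y y v) * hss

/-- Where `Y` does not vanish, constancy of `R ± 𝓕` forces the constant to be zero. -/
lemma const_eq_zero (hε : ε = 1 ∨ ε = -1) {s : ℝ} (hs : s = 1 ∨ s = -1) {c : ℝ}
    (hc : ∀ x, scalarCurvature h x + s * faradayFunction h J Y x = c) {x : M} (hx : Y x ≠ 0) :
    c = 0 := by
  have hss : s * s = 1 := by rcases hs with rfl | rfl <;> norm_num
  -- The differential of a constant is zero, while `η (J Y) = -|Y|²` is not.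
  have key : ∀ y, Y y ≠ 0 → ε * faradayFunction h J Y y + s * scalarCurvature h y = 0 := by
    intro y hy
    have e := hsol.mvfderiv_add_mul hJ y s (J y (Y y))
    rw [funext hc, mvfderiv_const, zero_apply] at e
    have := (mul_eq_zero.1 e.symm).resolve_right (momentForm_ne_zero hJ hy)
    linarith
  rcases hε with rfl | rfl
  · rw [← hc x]
    linear_combination s * key x hx - scalarCurvature h x * hss
  · have hp : pair h Y Y x ≠ 0 := (inner_self_pos hx).ne'
    -- For `ε = -1`, `key` and `hc` are independent equations that fix `R = c/2` wherever `Y ≠ 0`.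
    -- So `dR = 0` near `x`, which gives `𝓕 = 0` and then `R = 0` at `x`.
    have hloc : scalarCurvature h =ᶠ[𝓝 x] fun _ => c / 2 := by
      filter_upwards [((hsol.smooth x).pair h (hsol.smooth x)).continuousAt.eventually_ne hp]
        with y hy
      have hy' : Y y ≠ 0 := fun h0 => hy (by simp [pair, h0])
      have k := key y hy'
      have := hc y
      linear_combination (1 / 2) * this + (s / 2) * k - (scalarCurvature h y / 2) * hss
    have e := hsol.mvfderiv_scalarCurvature hJ x (J x (Y x))
    have e' : dirDeriv (rotate J Y) (scalarCurvature h) x = 0 := by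
      rw [dirDeriv_congr hloc, dirDeriv_const]
    have hF : faradayFunction h J Y x = 0 := by
      have := (mul_eq_zero.1 (e.symm.trans e')).resolve_right (momentForm_ne_zero hJ hx)
      linarith
    have k := key x hx
    have := hc x
    rw [hF] at k this
    linear_combination s * k - this - scalarCurvature h x * hss

/-- For `ε = 1`, `R² - 𝓕²` factors; a factor that vanishes at one point vanishes everywhere. For `ε
= -1` the left side is a sum of squares; conversely, at a point with `Y ≠ 0`, `R + s𝓕 = 0` and its
differential force `R = 𝓕 = 0`, while `Y = 0` everywhere gives `𝓕 = 0` directly. -/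
lemma sq_eq_zero_iff [ConnectedSpace M] (hε : ε = 1 ∨ ε = -1) {σ : ℝ}
    (hσ : ∀ x, scalarCurvature h x ^ 2 - ε * faradayFunction h J Y x ^ 2 = σ) :
    σ = 0 ↔ ∃ s : ℝ, (s = 1 ∨ s = -1) ∧
      ∀ x, scalarCurvature h x + s * faradayFunction h J Y x = 0 := by
  obtain ⟨x₀⟩ := (inferInstance : Nonempty M)
  constructor
  · rintro rfl
    rcases hε with rfl | rfl
    · have : (scalarCurvature h x₀ + 1 * faradayFunction h J Y x₀)
          * (scalarCurvature h x₀ + (-1) * faradayFunction h J Y x₀) = 0 := by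
        linear_combination hσ x₀
      rcases mul_eq_zero.1 this with h0 | h0
      · exact ⟨1, .inl rfl, hsol.add_mul_eq_zero hJ rfl (.inl rfl) h0⟩
      · exact ⟨-1, .inr rfl, hsol.add_mul_eq_zero hJ rfl (.inr rfl) h0⟩
    · refine ⟨1, .inl rfl, fun x => ?_⟩
      have h1 := hσ x
      have hR : scalarCurvature h x = 0 := by
        nlinarith [sq_nonneg (scalarCurvature h x), sq_nonneg (faradayFunction h J Y x)]
      have hF : faradayFunction h J Y x = 0 := by
        nlinarith [sq_nonneg (scalarCurvature h x), sq_nonneg (faradayFunction h J Y x)]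
      rw [hR, hF]; ring
  · rintro ⟨s, hs, hz⟩
    have hss : s * s = 1 := by rcases hs with rfl | rfl <;> norm_num
    rcases hε with rfl | rfl
    · rw [← hσ x₀]
      linear_combination (scalarCurvature h x₀ - s * faradayFunction h J Y x₀) * hz x₀
        + faradayFunction h J Y x₀ ^ 2 * hss
    · by_cases hY : ∀ x, Y x = 0
      · have hF := faradayFunction_eq_zero_of_field hJ hsol.killing hsol.smooth hY x₀
        have := hz x₀
        rw [← hσ x₀]
        rw [hF, mul_zero, add_zero] at this
        rw [hF, this]; ring
      · push Not at hY
        obtain ⟨x, hx⟩ := hY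
        have e := hsol.mvfderiv_add_mul hJ x s (J x (Y x))
        rw [funext hz, mvfderiv_const, zero_apply] at e
        have h1 := (mul_eq_zero.1 e.symm).resolve_right (momentForm_ne_zero hJ hx)
        have h2 := hz x
        have hR : scalarCurvature h x = 0 := by
          linear_combination (1 / 2) * h2 + (s / 4) * h1 - (scalarCurvature h x / 2) * hss
        have hF : faradayFunction h J Y x = 0 := by
          linear_combination (s / 2) * h2 - (1 / 4) * h1 - (faradayFunction h J Y x / 2) * hss
        rw [← hσ x, hR, hF]; ring

lemma isParallel_of_faraday (hF : ∀ x, faradayFunction h J Y x = 0) : IsParallel h Y := by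
  intro x X hX
  rw [hsol.killing.leviCivita_eq hJ (hsol.smooth x).diff hX.diff, hF]
  simp

/-- Off the flat case, a multiple of `log |R|` is a moment map. -/
lemma isMomentMap_log (hε : ε = 1) {s : ℝ} (hs : s = 1 ∨ s = -1)
    (hz : ∀ x, scalarCurvature h x + s * faradayFunction h J Y x = 0)
    (hne : ∀ x, scalarCurvature h x ≠ 0) :
    IsMomentMap id h J Y (fun x => -(s / 2) * Real.log (scalarCurvature h x)) := by
  have hss : s * s = 1 := by rcases hs with rfl | rfl <;> norm_num
  have hlog : ∀ x, SmoothFunAt (fun y => Real.log (scalarCurvature h y)) x := fun x =>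
    ((Real.contDiffAt_log.2 (hne x)).contMDiffAt).comp x (hsol.smooth_scalarCurvature x)
  refine ⟨fun x => contMDiffAt_const.mul (hlog x), fun x v => ?_⟩
  have hR := (hsol.smooth_scalarCurvature x).diff
  have e1 : mvfderiv (𝓡 2) (fun y => Real.log (scalarCurvature h y)) x v
      = (scalarCurvature h x)⁻¹ * mvfderiv (𝓡 2) (scalarCurvature h) x v := by
    have h1 := ((Real.hasDerivAt_log (hne x)).hasFDerivAt.hasMFDerivAt).comp x hR.hasMFDerivAt
    have h2 : mfderiv (𝓡 2) 𝓘(ℝ, ℝ) (fun y => Real.log (scalarCurvature h y)) x = _ := h1.mfderiv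
    simp only [mvfderiv, h2]
    exact mul_comm _ _
  rw [mvfderiv_fun_mul mdifferentiableAt_const (hlog x).diff, mvfderiv_const]
  simp only [smul_zero, add_zero, smul_apply, smul_eq_mul, e1, hsol.mvfderiv_scalarCurvature hJ,
    hε, hodgeStar, gammaForm, neg_apply, neg_neg, id, mfderiv_id]
  -- With this, `dR = 2𝓕η` reads `d log |R| = -2sη`, and `-(s/2)(-2s) = s² = 1`. `Real.log` is `log
  -- |·|`, so the sign of `R` is immaterial.
  have h3 : faradayFunction h J Y x = -s * scalarCurvature h x := by
    linear_combination s * hz x - faradayFunction h J Y x * hss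
  rw [h3]
  have := hne x
  simp only [momentForm, ContinuousLinearMap.comp_apply]
  field_simp
  refine (congrArg (· * _) ((sq s).trans hss)).trans (one_mul _)

end IsRealVortex

end Consequences

/-! ### Flatness, solitons and zeros of `Y` when `σ = 0`. -/

section Main

variable {M : Type u} [TopologicalSpace M] [ChartedSpace Plane M] [IsManifold (𝓡 2) ∞ M]
  {h : RiemMetric M} {J : Π x : M, TangentSpace (𝓡 2) x →L[ℝ] TangentSpace (𝓡 2) x}
  {Y : Π x : M, TangentSpace (𝓡 2) x} {ε τ : ℝ}

lemma isPullbackMetric_id (h : RiemMetric M) : IsPullbackMetric id h h := by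
  intro y v w
  simp [mfderiv_id]

namespace IsRealVortex

variable [ConnectedSpace M] (hsol : IsRealVortex h Y ε τ) (hJ : IsComplexStructure h J)
include hsol hJ

/-- If `R² = ε 𝓕²`, then `R ± 𝓕` is constant only if it vanishes. -/
lemma add_mul_eq_zero_of_const (hε : ε = 1 ∨ ε = -1)
    (hσ : ∀ x, scalarCurvature h x ^ 2 - ε * faradayFunction h J Y x ^ 2 = 0)
    {s : ℝ} (hs : s = 1 ∨ s = -1) {c : ℝ}
    (hc : ∀ x, scalarCurvature h x + s * faradayFunction h J Y x = c) (x : M) :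
    scalarCurvature h x + s * faradayFunction h J Y x = 0 := by
  -- For `Y = 0` constancy of `R + s𝓕` alone does not give zero; there `𝓕 = 0` and `σ = 0` yield `R
  -- = 0`.
  by_cases hY : ∀ y, Y y = 0
  · have hF := faradayFunction_eq_zero_of_field hJ hsol.killing hsol.smooth hY x
    have hR : scalarCurvature h x ^ 2 = 0 := by
      have := hσ x
      rw [hF] at this
      linarith
    rw [hF, pow_eq_zero_iff two_ne_zero |>.1 hR]
    ring
  · push Not at hY
    obtain ⟨y, hy⟩ := hY
    rw [hc, hsol.const_eq_zero hJ hε hs hc hy]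

/-- For `ε = 1` and `R ± 𝓕 = 0`, the metric is a steady gradient Ricci soliton. -/
lemma exists_soliton (hε : ε = 1) {s : ℝ} (hs : s = 1 ∨ s = -1)
    (hz : ∀ x, scalarCurvature h x + s * faradayFunction h J Y x = 0) :
    ∃ φ : M → ℝ, IsSteadyGradientRicciSoliton h φ := by
  by_cases hR : ∃ x, scalarCurvature h x = 0
  · obtain ⟨x, hx⟩ := hR
    exact ⟨_, isSteadyGradientRicciSoliton_zero (hsol.scalarCurvature_eq_zero hJ hε hs hz hx)⟩
  · push Not at hR
    exact ⟨_, isSteadyGradientRicciSoliton_of_isMomentMap hsol.killing hJ hsol.smooth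
      (Diffeomorph.refl (𝓡 2) M ∞).isLocalDiffeomorph (isPullbackMetric_id h) hz
      (hsol.isMomentMap_log hJ hε hs hz hR)⟩

lemma scalarCurvature_ne_zero_of_not_isFlat (hε : ε = 1) {s : ℝ} (hs : s = 1 ∨ s = -1)
    (hz : ∀ x, scalarCurvature h x + s * faradayFunction h J Y x = 0) (hflat : ¬ IsFlat h)
    (x : M) : scalarCurvature h x ≠ 0 := fun hx =>
  hflat (isFlat_of_scalarCurvature_eq_zero (hsol.scalarCurvature_eq_zero hJ hε hs hz hx))

lemma scalarCurvature_ne_zero_of_not_isParallel (hε : ε = 1) {s : ℝ} (hs : s = 1 ∨ s = -1)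
    (hz : ∀ x, scalarCurvature h x + s * faradayFunction h J Y x = 0) (hpar : ¬ IsParallel h Y)
    (x : M) : scalarCurvature h x ≠ 0 := by
  refine fun hx => hpar (hsol.isParallel_of_faraday hJ fun y => ?_)
  have h0 := hz y
  rw [hsol.scalarCurvature_eq_zero hJ hε hs hz hx, zero_add] at h0
  refine (mul_eq_zero.1 h0).resolve_left ?_
  rcases hs with rfl | rfl <;> norm_num

/-- A parallel field with a zero vanishes. -/
lemma eq_zero_of_faraday (hF : ∀ x, faradayFunction h J Y x = 0) {x₀ : M} (h0 : Y x₀ = 0)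
    (x : M) : Y x = 0 := by
  -- The length of `Y` is constant, since `d|Y|² = -(𝓕/2)η`.
  have e := eq_of_mvfderiv_eq_zero (g := pair h Y Y)
    (fun y => ((hsol.smooth y).pair h (hsol.smooth y)).diff)
    (fun y v => by rw [mvfderiv_pair_self hsol.killing hJ hsol.smooth, hF]; ring) x x₀
  by_contra hx
  refine (inner_self_pos (h := h) hx).ne' ?_
  simpa [pair, h0] using e.symm

/-- Since `R = τ - 4|Y|²`, the maximum `τ` of `R` is attained at the zero of `Y`. Either `R`
vanishes identically, or it has no zero; in the latter case, if `τ ≥ 0`, the intermediate value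
theorem makes `R` positive. -/
lemma alternative_of_zero (hε : ε = 1) {s : ℝ} (hs : s = 1 ∨ s = -1)
    (hz : ∀ x, scalarCurvature h x + s * faradayFunction h J Y x = 0) {x₀ : M} (h0 : Y x₀ = 0) :
    (IsFlat h ∧ ∀ x, Y x = 0) ∨
      (IsGreatest (Set.range (scalarCurvature h)) τ ∧ τ < 0) ∨
      ((∀ x, 0 < scalarCurvature h x) ∧ IsGreatest (Set.range (scalarCurvature h)) τ) := by
  have hx₀ : scalarCurvature h x₀ = τ := by
    rw [hsol.scalarCurvature_eq]
    simp [pair, h0]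
  have hmax : IsGreatest (Set.range (scalarCurvature h)) τ := by
    refine ⟨⟨x₀, hx₀⟩, ?_⟩
    rintro _ ⟨x, rfl⟩
    have hnn : 0 ≤ pair h Y Y x := by
      by_cases hx : Y x = 0
      · simp [pair, hx]
      · exact (inner_self_pos hx).le
    rw [hsol.scalarCurvature_eq, hε]
    linarith
  by_cases hR : ∃ x, scalarCurvature h x = 0
  · obtain ⟨x, hx⟩ := hR
    have hR0 := hsol.scalarCurvature_eq_zero hJ hε hs hz hx
    refine .inl ⟨isFlat_of_scalarCurvature_eq_zero hR0, hsol.eq_zero_of_faraday hJ (fun y => ?_) h0⟩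
    have h1 := hz y
    rw [hR0, zero_add] at h1
    refine (mul_eq_zero.1 h1).resolve_left ?_
    rcases hs with rfl | rfl <;> norm_num
  · refine .inr ?_
    rcases lt_or_ge τ 0 with hτ | hτ
    · exact .inl ⟨hmax, hτ⟩
    · refine .inr ⟨fun x => ?_, hmax⟩
      by_contra hx
      have hcont : Continuous (scalarCurvature h) :=
        continuous_iff_continuousAt.2 fun y => (hsol.smooth_scalarCurvature y).continuousAt
      exact hR (mem_range_of_exists_le_of_exists_ge hcont ⟨x, not_lt.1 hx⟩ ⟨x₀, hx₀ ▸ hτ⟩)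

end IsRealVortex

end Main

end RealVortex

theorem mainTheorem5
    {M : Type u} [TopologicalSpace M] [T2Space M] [ConnectedSpace M]
    [ChartedSpace Plane M] [IsManifold (𝓡 2) ∞ M]
    (h : RiemMetric M)
    (J : Π x : M, TangentSpace (𝓡 2) x →L[ℝ] TangentSpace (𝓡 2) x)
    (hJ : IsComplexStructure h J)
    (Y : Π x : M, TangentSpace (𝓡 2) x)
    (ε τ : ℝ) (hε : ε = 1 ∨ ε = -1)
    (hsol : IsRealVortex h Y ε τ)
    (R F : M → ℝ) (hR : R = scalarCurvature h) (hF : F = faradayFunction h J Y) :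
    ∃ σ : ℝ, (∀ x, R x ^ 2 - ε * F x ^ 2 = σ) ∧
      -- the equivalences
      ((∃ x, Y x ≠ 0) →
        List.TFAE [
          σ = 0,
          (∃ c : ℝ, ∀ x, R x + F x = c) ∨ (∃ c : ℝ, ∀ x, R x - F x = c),
          (∀ x, R x + F x = 0) ∨ (∀ x, R x - F x = 0)]) ∧
      (σ = 0 ↔ (∀ x, R x + F x = 0) ∨ (∀ x, R x - F x = 0)) ∧
      -- the consequences
      (σ = 0 →
        ((ε = -1 ∧ IsFlat h ∧ IsParallel h Y) ∨
          (ε = 1 ∧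
            (∃ φ : M → ℝ, IsSteadyGradientRicciSoliton h φ) ∧
            (¬ IsFlat h → ∃ μ : M → ℝ, IsMomentMap id h J Y μ) ∧
            (∀ s : ℝ, s = 1 ∨ s = -1 → (∃ c : ℝ, ∀ x, R x + s * F x = c) →
              ∀ (N : Type u) [TopologicalSpace N] [T2Space N] [ConnectedSpace N]
                [ChartedSpace Plane N] [IsManifold (𝓡 2) ∞ N] (p : N → M),
                IsCoveringMap p → IsLocalDiffeomorph (𝓡 2) (𝓡 2) ∞ p →
                ∀ k : RiemMetric N, IsPullbackMetric p h k →
                  ∀ μ : N → ℝ, IsMomentMap p h J Y μ →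
                    IsSteadyGradientRicciSoliton k (fun y => -2 * s * μ y)))) ∧
        (¬ IsParallel h Y → (∀ x, F x ≠ 0) ∧ (∀ x, R x ≠ 0)) ∧
        ((∃ x, Y x = 0) →
          (IsFlat h ∧ ∀ x, Y x = 0) ∨
          (IsGreatest (Set.range R) τ ∧ τ < 0) ∨
          ((∀ x, 0 < R x) ∧ IsGreatest (Set.range R) τ))) := by
  subst hR hF
  obtain ⟨σ, hσ⟩ := hsol.exists_conserved hJ
  -- Both signs are treated at once through `s = ±1`.
  have hsign : ∀ c : ℝ, (∃ s : ℝ, (s = 1 ∨ s = -1) ∧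
      ∀ x, scalarCurvature h x + s * faradayFunction h J Y x = c) ↔
      (∀ x, scalarCurvature h x + faradayFunction h J Y x = c) ∨
        ∀ x, scalarCurvature h x - faradayFunction h J Y x = c := by
    intro c
    simp only [or_and_right, exists_or, exists_eq_left, one_mul, neg_one_mul, sub_eq_add_neg]
  have hiff := (hsol.sq_eq_zero_iff hJ hε hσ).trans (hsign 0)
  refine ⟨σ, hσ, fun ⟨x₀, hx₀⟩ => ?_, hiff, ?_⟩
  · tfae_have 1 ↔ 3 := hiff
    tfae_have 3 → 2 := Or.imp (fun e => ⟨0, e⟩) fun e => ⟨0, e⟩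
    tfae_have 2 → 3 := by
      rw [← exists_or]
      rintro ⟨c, hc⟩
      obtain ⟨s, hs, hc'⟩ := (hsign c).2 hc
      rwa [hsol.const_eq_zero hJ hε hs hc' hx₀] at hc
    tfae_finish
  intro h0
  obtain ⟨s, hs, hz⟩ := (hsign 0).2 (hiff.1 h0)
  have hs0 : s ≠ 0 := by rcases hs with rfl | rfl <;> norm_num
  rw [h0] at hσ
  rcases hε with rfl | rfl
  · refine ⟨.inr ⟨rfl, hsol.exists_soliton hJ rfl hs hz, fun hflat => ⟨_, hsol.isMomentMap_log hJ
      rfl hs hz (hsol.scalarCurvature_ne_zero_of_not_isFlat hJ rfl hs hz hflat)⟩, ?_⟩, ?_, ?_⟩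
    · rintro t ht ⟨c, hc⟩ N _ _ _ _ _ p - hp k hk μ hμ
      exact isSteadyGradientRicciSoliton_of_isMomentMap hsol.killing hJ hsol.smooth hp hk
        (hsol.add_mul_eq_zero_of_const hJ (.inl rfl) hσ ht hc) hμ
    · intro hpar
      have hne := hsol.scalarCurvature_ne_zero_of_not_isParallel hJ rfl hs hz hpar
      refine ⟨fun x hx => hne x ?_, hne⟩
      simpa [hx] using hz x
    · rintro ⟨x₀, hx₀⟩
      exact hsol.alternative_of_zero hJ rfl hs hz hx₀
  · have hR0 : ∀ x, scalarCurvature h x = 0 := fun x => by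
      nlinarith [hσ x, sq_nonneg (scalarCurvature h x), sq_nonneg (faradayFunction h J Y x)]
    have hF0 : ∀ x, faradayFunction h J Y x = 0 := fun x => by
      nlinarith [hσ x, sq_nonneg (scalarCurvature h x), sq_nonneg (faradayFunction h J Y x)]
    have hpar := hsol.isParallel_of_faraday hJ hF0
    have hflat := isFlat_of_scalarCurvature_eq_zero hR0
    exact ⟨.inl ⟨rfl, hflat, hpar⟩, fun hn => (hn hpar).elim, fun ⟨x₀, hx₀⟩ =>
      .inl ⟨hflat, hsol.eq_zero_of_faraday hJ hF0 hx₀⟩⟩
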